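/- A graph is finite and simple. It is \emph{quasi-line} if the neighbourhood of every vertex can be partitioned into two (possibly empty) cliques. A \emph{hole of length $k$} is an induced cycle on $k\ge 4$ vertices; it is odd if $k$ is odd. A \emph{homogeneous pair of cliques} of a graph is a pair $(A,B)$ of disjoint nonempty cliques with $|A\cup B|\ge 3$ such that every vertex outside $A\cup B$ is adjacent either to all or to none of the vertices of $A$, and either to all or to none of the vertices of $B$; it is \emph{nonlinear} if the subgraph induced on $A\cup B$ contains an induced $C_4$. Theorem. There are an algorithm and a constant $C$ such that the following holds. Given the number of vertices and the edge list of any quasi-line graph $G$ with $n$ vertices and $m$ edges, the algorithm halts after at most $C(m^2+n+1)$ steps (hence in $O(m^2)$ time if $G$ is nonempty and has no isolated vertices) and outputs a vertex set $S\subseteq V(G)$ such that the induced subgraph $G'=G[S]$ satisfies: \begin{itemize} \item $G'$ is quasi-line and contains no nonlinear homogeneous pair of cliques, and \item for every odd $k$, if $G$ contains a hole of length $k$, then so does $G'$. \end{itemize} Here an algorithm is a fixed program for a random access machine with unit-cost memory access, tests for zero, addition, truncated subtraction and multiplication, zero-initialised memory, and words of $O(\log(n+m+2))$ bits: all numbers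 occurring in the run are at most $C(n+m+1)^C$. -/

import Mathlib

/-! ### Graph notions -/

namespace SimpleGraph

variable {V : Type*}

/-- Every vertex is bisimplicial: its neighbourhood is partitioned into two (possibly empty)
cliques. -/
def IsQuasiLine (G : SimpleGraph V) : Prop :=
  ∀ v : V, ∃ A B : Set V, G.IsClique A ∧ G.IsClique B ∧ Disjoint A B ∧ A ∪ B = G.neighborSet v

/-- `G` contains a hole of length `k`: an induced cycle on `k ≥ 4` vertices. -/
def HasHole (G : SimpleGraph V) (k : ℕ) : Prop :=
  4 ≤ k ∧ Nonempty (cycleGraph k ↪g G)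

/-- `(A, B)` is a homogeneous pair of cliques of `G`. -/
structure IsHomogeneousPairOfCliques (G : SimpleGraph V) (A B : Set V) : Prop where
  nonempty_left : A.Nonempty
  nonempty_right : B.Nonempty
  disjoint : Disjoint A B
  clique_left : G.IsClique A
  clique_right : G.IsClique B
  three_le : 3 ≤ (A ∪ B).encard
  homogeneous_left : ∀ v ∉ A ∪ B, (∀ a ∈ A, G.Adj v a) ∨ (∀ a ∈ A, ¬ G.Adj v a)
  homogeneous_right : ∀ v ∉ A ∪ B, (∀ b ∈ B, G.Adj v b) ∨ (∀ b ∈ B, ¬ G.Adj v b)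

/-- A homogeneous pair of cliques `(A, B)` is nonlinear if `G[A ∪ B]` contains an induced
four-cycle. -/
def IsNonlinearHomogeneousPair (G : SimpleGraph V) (A B : Set V) : Prop :=
  G.IsHomogeneousPairOfCliques A B ∧ Nonempty (cycleGraph 4 ↪g G.induce (A ∪ B))

end SimpleGraph

/-! ### A random access machine with structured programs

The memory is organised as arrays of natural numbers, indexed by natural numbers; all cells are
initially `0` apart from the input. A program is a fixed finite text, so it names only finitely
many arrays (interleaving them gives the usual single memory of a random access machine).
Every arithmetic operation, every memory access, every literal, and every test costs one step.
A run is confined to words of bounded size: every number that is computed, used as an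
index, or stored has to be at most a prescribed bound `W`. -/

namespace RAM

/-- Memory contents: `σ a i` is the entry with index `i` of the array named `a`. -/
abbrev Mem : Type := ℕ → ℕ → ℕ

/-- Expressions: literals, array accesses, sum, truncated difference, product. -/
inductive Expr : Type
  | lit (k : ℕ)
  | get (a : ℕ) (i : Expr)
  | add (e f : Expr)
  | sub (e f : Expr)
  | mul (e f : Expr)

namespace Expr

/-- The value of an expression. -/
def eval (σ : Mem) : Expr → ℕ
  | lit k => k
  | get a i => σ a (i.eval σ)
  | add e f => e.eval σ + f.eval σ
  | sub e f => e.eval σ - f.eval σ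
  | mul e f => e.eval σ * f.eval σ

/-- The number of steps needed to evaluate an expression: its number of operations. -/
def cost : Expr → ℕ
  | lit _ => 1
  | get _ i => i.cost + 1
  | add e f => e.cost + f.cost + 1
  | sub e f => e.cost + f.cost + 1
  | mul e f => e.cost + f.cost + 1

/-- All values that occur in the evaluation of an expression are at most `W`. -/
def Fits (W : ℕ) (σ : Mem) : Expr → Prop
  | lit k => k ≤ W
  | get a i => i.Fits W σ ∧ (get a i).eval σ ≤ W
  | add e f => e.Fits W σ ∧ f.Fits W σ ∧ (add e f).eval σ ≤ W
  | sub e f => e.Fits W σ ∧ f.Fits W σ ∧ (sub e f).eval σ ≤ W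
  | mul e f => e.Fits W σ ∧ f.Fits W σ ∧ (mul e f).eval σ ≤ W

end Expr

/-- Programs. `assign a i e` stores the value of `e` in the entry with index `i` of array `a`;
`ite c p q` runs `p` if `c` is nonzero and `q` otherwise; `loop c p` repeats `p` as long as `c`
is nonzero. -/
inductive Program : Type
  | skip
  | assign (a : ℕ) (i e : Expr)
  | seq (p q : Program)
  | ite (c : Expr) (p q : Program)
  | loop (c : Expr) (p : Program)

/-- The memory after storing `x` in the entry with index `i` of array `a`. -/
def Mem.store (σ : Mem) (a i x : ℕ) : Mem :=
  Function.update σ a (Function.update (σ a) i x)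

/-- `Runs W p σ τ t`: started with memory `σ`, the program `p` halts after exactly `t` steps with
memory `τ`, and no value exceeds `W` during the run. -/
inductive Runs (W : ℕ) : Program → Mem → Mem → ℕ → Prop
  | skip (σ : Mem) : Runs W .skip σ σ 1
  | assign (σ : Mem) (a : ℕ) (i e : Expr) (hi : i.Fits W σ) (he : e.Fits W σ) :
      Runs W (.assign a i e) σ (σ.store a (i.eval σ) (e.eval σ)) (i.cost + e.cost + 1)
  | seq {p q : Program} {σ τ υ : Mem} {s t : ℕ} (hp : Runs W p σ τ s) (hq : Runs W q τ υ t) :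
      Runs W (.seq p q) σ υ (s + t)
  | iteTrue {c : Expr} {p q : Program} {σ τ : Mem} {t : ℕ} (hc : c.Fits W σ)
      (h : c.eval σ ≠ 0) (hp : Runs W p σ τ t) : Runs W (.ite c p q) σ τ (c.cost + 1 + t)
  | iteFalse {c : Expr} {p q : Program} {σ τ : Mem} {t : ℕ} (hc : c.Fits W σ)
      (h : c.eval σ = 0) (hq : Runs W q σ τ t) : Runs W (.ite c p q) σ τ (c.cost + 1 + t)
  | loopDone {c : Expr} {p : Program} {σ : Mem} (hc : c.Fits W σ) (h : c.eval σ = 0) :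
      Runs W (.loop c p) σ σ (c.cost + 1)
  | loopStep {c : Expr} {p : Program} {σ τ υ : Mem} {s t : ℕ} (hc : c.Fits W σ)
      (h : c.eval σ ≠ 0) (hp : Runs W p σ τ s) (hl : Runs W (.loop c p) τ υ t) :
      Runs W (.loop c p) σ υ (c.cost + 1 + s + t)

/-- `es` lists every edge of `G` exactly once, in any order and with its two ends in any order. -/
def IsEdgeList {n : ℕ} (G : SimpleGraph (Fin n)) (es : List (Fin n × Fin n)) : Prop :=
  (es.map fun e => s(e.1, e.2)).Nodup ∧ ∀ e : Sym2 (Fin n),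
    e ∈ es.map (fun e => s(e.1, e.2)) ↔ e ∈ G.edgeSet

/-- The initial memory for a graph on `Fin n` with edge list `es`: array `0` holds the number of
vertices and the number of edges, arrays `1` and `2` hold the first and the second ends of the
edges in the list; every other entry is `0`. -/
def input (n : ℕ) (es : List (Fin n × Fin n)) : Mem
  | 0, 0 => n
  | 0, 1 => es.length
  | 1, i => (es.map fun e => (e.1 : ℕ)).getD i 0
  | 2, i => (es.map fun e => (e.2 : ℕ)).getD i 0
  | _, _ => 0

/-- The output vertex set, read off array `3`: the vertices whose entry is nonzero. -/
def output (n : ℕ) (τ : Mem) : Set (Fin n) :=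
  {v | τ 3 v ≠ 0}

end RAM

/-! Work inside a shrinking set `S` of surviving vertices. A nonlinear pair contains an induced
four-cycle `x₁ x₂ y₂ y₁` with `x₁`, `x₂` on one side and `y₁`, `y₂` on the other, so it is enough to
examine each edge `x₁x₂` and ask whether some pair has such a cycle with both ends of the edge on
one side.

If such a pair exists, every vertex of `S` that tells two members of one side apart (`SeesOnly`)
must lie on the other side (`mem_right_of_seesOnly`). Hence `y₁` and `y₂` may be any vertices that
tell `x₁` from `x₂` in the two directions (`replace`), and the pair contains the closure of the
four-cycle under this forcing rule. A breadth-first search computes the closure. If two forced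
vertices on one side are non-adjacent, there is no pair; otherwise the closure itself is one
(`ClosureState.nonlinearPairOn`).

A pair `(X, Y)` that is found is replaced by `({x₁}, {y₁, y₂})`. A hole with at least five vertices
meets each side at most once (`hole_subsingleton`), and since `x₁` has both a neighbour and a
non-neighbour among `y₁`, `y₂`, the hole can be redrawn in what remains (`hasHoleOn_shrink`).
Moreover, a nonlinear pair after the replacement extends to one before it with the same four-cycle
(`lift`). So an edge that has been dealt with never needs a second look: it had no pair, or it has
lost its end `x₂`. One pass over the edge list suffices (`Reduced.step`).

For the running time, let `D` bound the degrees. The processed vertices on each side form a clique,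
so at most `2D + 2` vertices are processed successfully for each edge, each in `O(D)` steps. In a
quasi-line graph `D ^ 2 ≤ 4m` can be achieved (`degree_sq_le`), so an edge costs `O(m + 1)`. Giving
every edge its own zero row for the side marks avoids clearing memory. The word size is handled
separately: the program stores only values that exceed earlier memory entries by at most `3`
(`Exec.runs`), so the time bound also bounds the numbers. -/

namespace SimpleGraph

/-! ### Nonlinear pairs and the effect of shrinking one of them -/

variable {V : Type*} {G : SimpleGraph V}

/-- `(X, Y)` is a homogeneous pair of cliques of `G[S]`, and `x₁ x₂ y₂ y₁` is an induced four-cycle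
with `x₁, x₂ ∈ X` and `y₁, y₂ ∈ Y`. -/
structure NonlinearPairOn (G : SimpleGraph V) (S X Y : Set V) (x₁ x₂ y₁ y₂ : V) : Prop where
  subset_left : ∀ v ∈ X, v ∈ S
  subset_right : ∀ v ∈ Y, v ∈ S
  disjoint : ∀ v ∈ X, v ∉ Y
  clique_left : ∀ a ∈ X, ∀ b ∈ X, a ≠ b → G.Adj a b
  clique_right : ∀ a ∈ Y, ∀ b ∈ Y, a ≠ b → G.Adj a b
  hom_left : ∀ v ∈ S, v ∉ X → v ∉ Y → ∀ a ∈ X, ∀ b ∈ X, G.Adj v a → G.Adj v b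
  hom_right : ∀ v ∈ S, v ∉ X → v ∉ Y → ∀ a ∈ Y, ∀ b ∈ Y, G.Adj v a → G.Adj v b
  mem_x₁ : x₁ ∈ X
  mem_x₂ : x₂ ∈ X
  mem_y₁ : y₁ ∈ Y
  mem_y₂ : y₂ ∈ Y
  adj₁ : G.Adj x₁ y₁
  adj₂ : G.Adj x₂ y₂
  not_adj₁ : ¬ G.Adj x₁ y₂
  not_adj₂ : ¬ G.Adj x₂ y₁

/-- The vertices that remain when the pair `(X, Y)` is shrunk to `({x₁}, {y₁, y₂})`. -/
def shrink (S X Y : Set V) (x₁ y₁ y₂ : V) : Set V :=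
  {v | v ∈ S ∧ v ∉ X ∧ v ∉ Y ∨ v = x₁ ∨ v = y₁ ∨ v = y₂}

namespace NonlinearPairOn

variable {S X Y A B : Set V} {x₁ x₂ y₁ y₂ a₁ a₂ b₁ b₂ : V}

theorem swap (h : G.NonlinearPairOn S X Y x₁ x₂ y₁ y₂) :
    G.NonlinearPairOn S Y X y₁ y₂ x₁ x₂ where
  subset_left := h.subset_right
  subset_right := h.subset_left
  disjoint v hv hv' := h.disjoint v hv' hv
  clique_left := h.clique_right
  clique_right := h.clique_left
  hom_left v hv h₁ h₂ := h.hom_right v hv h₂ h₁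
  hom_right v hv h₁ h₂ := h.hom_left v hv h₂ h₁
  mem_x₁ := h.mem_y₁
  mem_x₂ := h.mem_y₂
  mem_y₁ := h.mem_x₁
  mem_y₂ := h.mem_x₂
  adj₁ := h.adj₁.symm
  adj₂ := h.adj₂.symm
  not_adj₁ e := h.not_adj₂ e.symm
  not_adj₂ e := h.not_adj₁ e.symm

theorem flip (h : G.NonlinearPairOn S X Y x₁ x₂ y₁ y₂) :
    G.NonlinearPairOn S X Y x₂ x₁ y₂ y₁ :=
  { h with
    mem_x₁ := h.mem_x₂, mem_x₂ := h.mem_x₁, mem_y₁ := h.mem_y₂, mem_y₂ := h.mem_y₁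
    adj₁ := h.adj₂, adj₂ := h.adj₁, not_adj₁ := h.not_adj₂, not_adj₂ := h.not_adj₁ }

theorem ne_x (h : G.NonlinearPairOn S X Y x₁ x₂ y₁ y₂) : x₁ ≠ x₂ := by
  rintro rfl; exact h.not_adj₁ h.adj₂

theorem ne_y (h : G.NonlinearPairOn S X Y x₁ x₂ y₁ y₂) : y₁ ≠ y₂ := h.swap.ne_x

/-- A vertex that is complete or anticomplete to the other side can be removed. -/
theorem diff_singleton (h : G.NonlinearPairOn S X Y x₁ x₂ y₁ y₂) {z : V} (hz : z ∈ X)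
    (hom : ∀ a ∈ Y, ∀ b ∈ Y, G.Adj z a → G.Adj z b) :
    G.NonlinearPairOn S (X \ {z}) Y x₁ x₂ y₁ y₂ := by
  -- Each of `x₁`, `x₂` separates `y₁` from `y₂`, so a vertex that is homogeneous to `Y` is neither
  -- of them.
  have hx₁ : x₁ ≠ z := by
    rintro rfl; exact h.not_adj₁ (hom _ h.mem_y₁ _ h.mem_y₂ h.adj₁)
  have hx₂ : x₂ ≠ z := by
    rintro rfl; exact h.not_adj₂ (hom _ h.mem_y₂ _ h.mem_y₁ h.adj₂)
  refine { h with
    subset_left := fun v hv => h.subset_left v hv.1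
    disjoint := fun v hv => h.disjoint v hv.1
    clique_left := fun a ha b hb => h.clique_left a ha.1 b hb.1
    hom_left := ?_
    hom_right := ?_
    mem_x₁ := ⟨h.mem_x₁, hx₁⟩
    mem_x₂ := ⟨h.mem_x₂, hx₂⟩ }
  · intro v hv hvX hvY a ha b hb hab
    by_cases hvz : v = z
    · subst hvz; exact h.clique_left _ hz _ hb.1 (Ne.symm hb.2)
    · exact h.hom_left v hv (fun h' => hvX ⟨h', hvz⟩) hvY a ha.1 b hb.1 hab
  · intro v hv hvX hvY a ha b hb hab
    by_cases hvz : v = z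
    · subst hvz; exact hom a ha b hb hab
    · exact h.hom_right v hv (fun h' => hvX ⟨h', hvz⟩) hvY a ha b hb hab


theorem mem_of_mem_shrink (h : G.NonlinearPairOn S A B a₁ a₂ b₁ b₂) {v : V}
    (hv : v ∈ shrink S A B a₁ b₁ b₂) : v ∈ S := by
  rcases hv with hv | rfl | rfl | rfl
  exacts [hv.1, h.subset_left _ h.mem_x₁, h.subset_right _ h.mem_y₁, h.subset_right _ h.mem_y₂]

/-- The vertices of `X` and `Y` survive outside `A ∪ B`, so they cannot distinguish a deleted vertex
of `A` from `a₁`, or one of `B` from `b₁`. The deleted vertices therefore inherit homogeneity from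
these representatives. -/
theorem lift_of_disjoint (h : G.NonlinearPairOn S A B a₁ a₂ b₁ b₂)
    (h' : G.NonlinearPairOn (shrink S A B a₁ b₁ b₂) X Y x₁ x₂ y₁ y₂)
    (ha : a₁ ∉ X ∧ a₁ ∉ Y) (hb₁ : b₁ ∉ X ∧ b₁ ∉ Y) (hb₂ : b₂ ∉ X ∧ b₂ ∉ Y) :
    G.NonlinearPairOn S X Y x₁ x₂ y₁ y₂ := by
  have key : ∀ Z : Set V, (∀ v ∈ Z, v ∈ shrink S A B a₁ b₁ b₂) → a₁ ∉ Z → b₁ ∉ Z → b₂ ∉ Z →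
      (∀ v ∈ shrink S A B a₁ b₁ b₂, v ∉ X → v ∉ Y → ∀ a ∈ Z, ∀ b ∈ Z, G.Adj v a → G.Adj v b) →
      ∀ v ∈ S, v ∉ X → v ∉ Y → ∀ a ∈ Z, ∀ b ∈ Z, G.Adj v a → G.Adj v b := by
    intro Z hZ hZ₁ hZ₂ hZ₃ hom v hv hvX hvY a haZ b hbZ hab
    have out : ∀ z ∈ Z, z ∈ S ∧ z ∉ A ∧ z ∉ B := by
      intro z hz
      rcases hZ z hz with h1 | rfl | rfl | rfl
      exacts [h1, absurd hz hZ₁, absurd hz hZ₂, absurd hz hZ₃]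
    obtain ⟨haS, haA, haB⟩ := out a haZ
    obtain ⟨hbS, hbA, hbB⟩ := out b hbZ
    by_cases hvA : v ∈ A
    · have h1 := h.hom_left a haS haA haB v hvA a₁ h.mem_x₁ hab.symm
      have h2 := hom a₁ (Or.inr (Or.inl rfl)) ha.1 ha.2 a haZ b hbZ h1.symm
      exact (h.hom_left b hbS hbA hbB a₁ h.mem_x₁ v hvA h2.symm).symm
    by_cases hvB : v ∈ B
    · have h1 := h.hom_right a haS haA haB v hvB b₁ h.mem_y₁ hab.symm
      have h2 := hom b₁ (Or.inr (Or.inr (Or.inl rfl))) hb₁.1 hb₁.2 a haZ b hbZ h1.symm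
      exact (h.hom_right b hbS hbA hbB b₁ h.mem_y₁ v hvB h2.symm).symm
    exact hom v (Or.inl ⟨hv, hvA, hvB⟩) hvX hvY a haZ b hbZ hab
  exact { h' with
    subset_left := fun v hv => h.mem_of_mem_shrink (h'.subset_left v hv)
    subset_right := fun v hv => h.mem_of_mem_shrink (h'.subset_right v hv)
    hom_left := key X h'.subset_left ha.1 hb₁.1 hb₂.1 h'.hom_left
    hom_right := key Y h'.subset_right ha.2 hb₁.2 hb₂.2 h'.hom_right }

/-- The common vertices `a₁` of `X` and `A`, and `b` of `Y` and `B`, glue the two pairs. A vertex of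
`X` outside `A` is adjacent to `a₁`, hence to all of `A`; likewise for `Y` and `B` through `b`. A
vertex outside both unions treats each union as it treats the common vertex. -/
theorem lift_union (h : G.NonlinearPairOn S A B a₁ a₂ b₁ b₂)
    (h' : G.NonlinearPairOn (shrink S A B a₁ b₁ b₂) X Y x₁ x₂ y₁ y₂)
    (ha : a₁ ∈ X) (hb₁ : b₁ ∉ X) (hb₂ : b₂ ∉ X) {b : V} (hbB : b ∈ B) (hbY : b ∈ Y) :
    G.NonlinearPairOn S (X ∪ A) (Y ∪ B) x₁ x₂ y₁ y₂ := by
  have haY : a₁ ∉ Y := h'.disjoint _ ha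
  have outX : ∀ v ∈ X, v ∈ S ∧ v ∉ A ∧ v ∉ B ∨ v = a₁ := by
    intro v hv
    rcases h'.subset_left v hv with h1 | rfl | rfl | rfl
    exacts [Or.inl h1, Or.inr rfl, absurd hv hb₁, absurd hv hb₂]
  have outY : ∀ v ∈ Y, v ∈ S ∧ v ∉ A ∧ v ∉ B ∨ v ∈ B := by
    intro v hv
    rcases h'.subset_right v hv with h1 | rfl | rfl | rfl
    exacts [Or.inl h1, absurd hv haY, Or.inr h.mem_y₁, Or.inr h.mem_y₂]
  have hXA : ∀ x ∈ X, ∀ a ∈ A, x ≠ a → G.Adj x a := by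
    intro x hx a haA hne
    rcases outX x hx with h1 | rfl
    · refine h.hom_left x h1.1 h1.2.1 h1.2.2 a₁ h.mem_x₁ a haA (h'.clique_left _ hx _ ha ?_)
      rintro rfl; exact h1.2.1 h.mem_x₁
    · exact h.clique_left _ h.mem_x₁ _ haA hne
  have hYB : ∀ y ∈ Y, ∀ c ∈ B, y ≠ c → G.Adj y c := by
    intro y hy c hc hne
    rcases outY y hy with h1 | h1
    · refine h.hom_right y h1.1 h1.2.1 h1.2.2 b hbB c hc (h'.clique_right _ hy _ hbY ?_)
      rintro rfl; exact h1.2.2 hbB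
    · exact h.clique_right _ h1 _ hc hne
  refine { h' with
    subset_left := ?_, subset_right := ?_, disjoint := ?_, clique_left := ?_, clique_right := ?_
    hom_left := ?_, hom_right := ?_
    mem_x₁ := Or.inl h'.mem_x₁, mem_x₂ := Or.inl h'.mem_x₂
    mem_y₁ := Or.inl h'.mem_y₁, mem_y₂ := Or.inl h'.mem_y₂ }
  · rintro v (hv | hv)
    exacts [h.mem_of_mem_shrink (h'.subset_left v hv), h.subset_left v hv]
  · rintro v (hv | hv)
    exacts [h.mem_of_mem_shrink (h'.subset_right v hv), h.subset_right v hv]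
  · rintro v (hv | hv) (hv' | hv')
    · exact h'.disjoint v hv hv'
    · rcases outX v hv with h1 | rfl
      exacts [h1.2.2 hv', h.disjoint _ h.mem_x₁ hv']
    · rcases outY v hv' with h1 | h1
      exacts [h1.2.1 hv, h.disjoint _ hv h1]
    · exact h.disjoint v hv hv'
  · rintro u (hu | hu) v (hv | hv) hne
    exacts [h'.clique_left _ hu _ hv hne, hXA _ hu _ hv hne, (hXA _ hv _ hu hne.symm).symm,
      h.clique_left _ hu _ hv hne]
  · rintro u (hu | hu) v (hv | hv) hne
    exacts [h'.clique_right _ hu _ hv hne, hYB _ hu _ hv hne, (hYB _ hv _ hu hne.symm).symm,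
      h.clique_right _ hu _ hv hne]
  · intro v hv hvX hvY
    have hvA : v ∉ A := fun e => hvX (Or.inr e)
    have hvB : v ∉ B := fun e => hvY (Or.inr e)
    have hom := h'.hom_left v (Or.inl ⟨hv, hvA, hvB⟩) (fun e => hvX (Or.inl e))
      (fun e => hvY (Or.inl e))
    have homA := h.hom_left v hv hvA hvB
    have eqv : ∀ z ∈ X ∪ A, (G.Adj v z ↔ G.Adj v a₁) := by
      rintro z (hz | hz)
      exacts [⟨hom z hz _ ha, hom _ ha z hz⟩, ⟨homA z hz _ h.mem_x₁, homA _ h.mem_x₁ z hz⟩]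
    intro p hp q hq hpq
    exact (eqv q hq).2 ((eqv p hp).1 hpq)
  · intro v hv hvX hvY
    have hvA : v ∉ A := fun e => hvX (Or.inr e)
    have hvB : v ∉ B := fun e => hvY (Or.inr e)
    have hom := h'.hom_right v (Or.inl ⟨hv, hvA, hvB⟩) (fun e => hvX (Or.inl e))
      (fun e => hvY (Or.inl e))
    have homB := h.hom_right v hv hvA hvB
    have eqv : ∀ z ∈ Y ∪ B, (G.Adj v z ↔ G.Adj v b) := by
      rintro z (hz | hz)
      exacts [⟨hom z hz _ hbY, hom _ hbY z hz⟩, ⟨homB z hz _ hbB, homB _ hbB z hz⟩]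
    intro p hp q hq hpq
    exact (eqv q hq).2 ((eqv p hp).1 hpq)

/-- Outside `{a₁, b₁, b₂}` the vertices `b₁` and `b₂` have the same neighbours. -/
theorem adj_iff_of_mem_shrink (h : G.NonlinearPairOn S A B a₁ a₂ b₁ b₂) {v : V}
    (hv : v ∈ shrink S A B a₁ b₁ b₂) (ha : v ≠ a₁) (hb₁ : v ≠ b₁) (hb₂ : v ≠ b₂) :
    G.Adj v b₁ ↔ G.Adj v b₂ := by
  rcases hv with h1 | h1 | h1 | h1
  · have := h.hom_right v h1.1 h1.2.1 h1.2.2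
    exact ⟨this _ h.mem_y₁ _ h.mem_y₂, this _ h.mem_y₂ _ h.mem_y₁⟩
  exacts [absurd h1 ha, absurd h1 hb₁, absurd h1 hb₂]

/-- Since `b₂` is not adjacent to `a₁`, it is not in `X`. If `b₁` is in `X`, then `b₂` must be in
`Y`, since otherwise it would separate `b₁` from `a₁`; then `b₁` is complete to `Y` and can be
dropped. In the remaining cases `Y` meets `{b₁, b₂}` and the pairs are glued, or a second vertex of
`X` contradicts the fact that `b₁` and `b₂` are twins away from `a₁`. -/
theorem lift_of_mem_left (h : G.NonlinearPairOn S A B a₁ a₂ b₁ b₂)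
    (h' : G.NonlinearPairOn (shrink S A B a₁ b₁ b₂) X Y x₁ x₂ y₁ y₂) (ha : a₁ ∈ X) :
    ∃ X' Y', G.NonlinearPairOn S X' Y' x₁ x₂ y₁ y₂ := by
  have hab : a₁ ≠ b₁ := h.adj₁.ne
  have hab' : a₁ ≠ b₂ := by rintro e; exact h.disjoint _ h.mem_x₁ (e ▸ h.mem_y₂)
  have hbb : G.Adj b₁ b₂ := h.clique_right _ h.mem_y₁ _ h.mem_y₂ h.ne_y
  have tw := fun v hv => @adj_iff_of_mem_shrink _ _ _ _ _ _ _ _ _ h v hv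
  have hm₁ : b₁ ∈ shrink S A B a₁ b₁ b₂ := Or.inr (Or.inr (Or.inl rfl))
  have hm₂ : b₂ ∈ shrink S A B a₁ b₁ b₂ := Or.inr (Or.inr (Or.inr rfl))
  have hb₂X : b₂ ∉ X := fun e => h.not_adj₁ (h'.clique_left _ ha _ e hab')
  have haY : a₁ ∉ Y := h'.disjoint _ ha
  by_cases hb₁X : b₁ ∈ X
  · by_cases hb₂Y : b₂ ∈ Y
    · have com : ∀ y ∈ Y, G.Adj b₁ y := by
        intro y hy
        by_cases e : y = b₂
        · rw [e]; exact hbb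
        · have hy₁ : y ≠ b₁ := by rintro rfl; exact h'.disjoint _ hb₁X hy
          have hya : y ≠ a₁ := by rintro rfl; exact haY hy
          exact ((tw y (h'.subset_right y hy) hya hy₁ e).2 (h'.clique_right _ hy _ hb₂Y e)).symm
      have h'' := h'.diff_singleton hb₁X (fun a _ b hb _ => com b hb)
      exact ⟨_, _, h.lift_union h'' ⟨ha, hab⟩ (fun e => e.2 rfl) (fun e => hb₂X e.1) h.mem_y₂ hb₂Y⟩
    · exact absurd (h'.hom_left _ hm₂ hb₂X hb₂Y _ hb₁X _ ha hbb.symm).symm h.not_adj₁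
  · by_cases hb₁Y : b₁ ∈ Y
    · exact ⟨_, _, h.lift_union h' ha hb₁X hb₂X h.mem_y₁ hb₁Y⟩
    by_cases hb₂Y : b₂ ∈ Y
    · exact ⟨_, _, h.lift_union h' ha hb₁X hb₂X h.mem_y₂ hb₂Y⟩
    exfalso
    obtain ⟨x, hx, hxa⟩ : ∃ x ∈ X, x ≠ a₁ := by
      by_cases e : x₁ = a₁
      · exact ⟨x₂, h'.mem_x₂, fun e' => h'.ne_x (e.trans e'.symm)⟩
      · exact ⟨x₁, h'.mem_x₁, e⟩
    have h1 := h'.hom_left _ hm₁ hb₁X hb₁Y _ ha _ hx h.adj₁.symm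
    have h2 := (tw x (h'.subset_left x hx) hxa (fun e => hb₁X (e ▸ hx))
      (fun e => hb₂X (e ▸ hx))).1 h1.symm
    exact h.not_adj₁ (h'.hom_left _ hm₂ hb₂X hb₂Y _ hx _ ha h2.symm).symm


/-- The vertex `a₁` lies outside the pair and separates `b` from `b'`, so `b'` is not in `X`. If
`b'` is in `Y`, its twin `b` is complete to `Y`; otherwise `b'` is homogeneous to `Y` and `b` copies
it. -/
theorem hom_of_mem_pair (h : G.NonlinearPairOn S A B a₁ a₂ b₁ b₂)
    (h' : G.NonlinearPairOn (shrink S A B a₁ b₁ b₂) X Y x₁ x₂ y₁ y₂) (haX : a₁ ∉ X) (haY : a₁ ∉ Y)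
    {b b' : V} (hb : b = b₁ ∧ b' = b₂ ∨ b = b₂ ∧ b' = b₁) (hbX : b ∈ X) :
    ∀ p ∈ Y, ∀ q ∈ Y, G.Adj b p → G.Adj b q := by
  have hbb : G.Adj b b' := by
    have := h.clique_right _ h.mem_y₁ _ h.mem_y₂ h.ne_y
    rcases hb with ⟨rfl, rfl⟩ | ⟨rfl, rfl⟩
    exacts [this, this.symm]
  have tw : ∀ v ∈ shrink S A B a₁ b₁ b₂, v ≠ a₁ → v ≠ b → v ≠ b' → (G.Adj v b ↔ G.Adj v b') := by
    intro v hv hva hvb hvb'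
    rcases hb with ⟨rfl, rfl⟩ | ⟨rfl, rfl⟩
    exacts [h.adj_iff_of_mem_shrink hv hva hvb hvb', (h.adj_iff_of_mem_shrink hv hva hvb' hvb).symm]
  have hm₀ : a₁ ∈ shrink S A B a₁ b₁ b₂ := Or.inr (Or.inl rfl)
  have hm : b' ∈ shrink S A B a₁ b₁ b₂ := by
    rcases hb with ⟨rfl, rfl⟩ | ⟨rfl, rfl⟩
    exacts [Or.inr (Or.inr (Or.inr rfl)), Or.inr (Or.inr (Or.inl rfl))]
  have hb'X : b' ∉ X := by
    intro hb'
    have h0 := h'.hom_left _ hm₀ haX haY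
    rcases hb with ⟨rfl, rfl⟩ | ⟨rfl, rfl⟩
    exacts [h.not_adj₁ (h0 _ hbX _ hb' h.adj₁), h.not_adj₁ (h0 _ hb' _ hbX h.adj₁)]
  have twY : ∀ y ∈ Y, y ≠ b' → (G.Adj y b ↔ G.Adj y b') := fun y hy hne =>
    tw y (h'.subset_right y hy) (fun e => haY (e ▸ hy))
      (fun e => h'.disjoint _ hbX (e ▸ hy)) hne
  intro p hp q hq hbp
  by_cases hb'Y : b' ∈ Y
  · by_cases e : q = b'
    · rw [e]; exact hbb
    · exact ((twY q hq e).2 (h'.clique_right _ hq _ hb'Y e)).symm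
  · have h1 := (twY p hp (fun e => hb'Y (e ▸ hp))).1 hbp.symm
    have h2 := h'.hom_right _ hm hb'X hb'Y p hp q hq h1.symm
    exact ((twY q hq (fun e => hb'Y (e ▸ hq))).2 h2.symm).symm

theorem exists_diff_pair (h : G.NonlinearPairOn S A B a₁ a₂ b₁ b₂)
    (h' : G.NonlinearPairOn (shrink S A B a₁ b₁ b₂) X Y x₁ x₂ y₁ y₂) (haX : a₁ ∉ X) (haY : a₁ ∉ Y)
    {b b' : V} (hb : b = b₁ ∧ b' = b₂ ∨ b = b₂ ∧ b' = b₁) :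
    G.NonlinearPairOn (shrink S A B a₁ b₁ b₂) (X \ {b}) (Y \ {b}) x₁ x₂ y₁ y₂ := by
  by_cases hbX : b ∈ X
  · rw [Set.sdiff_singleton_eq_self (h'.disjoint _ hbX)]
    exact h'.diff_singleton hbX (h.hom_of_mem_pair h' haX haY hb hbX)
  · rw [Set.sdiff_singleton_eq_self hbX]
    by_cases hbY : b ∈ Y
    · exact (h'.swap.diff_singleton hbY (h.hom_of_mem_pair h'.swap haY haX hb hbY)).swap
    · rwa [Set.sdiff_singleton_eq_self hbY]

/-- Shrinking a nonlinear pair creates no new nonlinear pairs. -/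
theorem lift (h : G.NonlinearPairOn S A B a₁ a₂ b₁ b₂)
    (h' : G.NonlinearPairOn (shrink S A B a₁ b₁ b₂) X Y x₁ x₂ y₁ y₂) :
    ∃ X' Y', G.NonlinearPairOn S X' Y' x₁ x₂ y₁ y₂ := by
  by_cases haX : a₁ ∈ X
  · exact h.lift_of_mem_left h' haX
  by_cases haY : a₁ ∈ Y
  · obtain ⟨X', Y', hX⟩ := h.lift_of_mem_left h'.swap haY
    exact ⟨_, _, hX.swap⟩
  -- With `a₁` outside the pair, `b₁` and `b₂` can be dropped in turn, which leaves a pair disjoint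
  -- from all three survivors.
  have h₁ := h.exists_diff_pair h' haX haY (Or.inl ⟨rfl, rfl⟩)
  have h₂ := h.exists_diff_pair h₁ (fun e => haX e.1) (fun e => haY e.1) (Or.inr ⟨rfl, rfl⟩)
  exact ⟨_, _, h.lift_of_disjoint h₂ ⟨fun e => haX e.1.1, fun e => haY e.1.1⟩
    ⟨fun e => e.1.2 rfl, fun e => e.1.2 rfl⟩ ⟨fun e => e.2 rfl, fun e => e.2 rfl⟩⟩

end NonlinearPairOn

/-! ### Holes under shrinking -/

/-- `G[S]` contains a hole of length `k`. -/
def HasHoleOn (G : SimpleGraph V) (S : Set V) (k : ℕ) : Prop :=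
  4 ≤ k ∧ ∃ f : cycleGraph k ↪g G, ∀ i, f i ∈ S

theorem cycleGraph_adj_val {k : ℕ} (hk : 4 ≤ k) (i j : Fin k) :
    (cycleGraph k).Adj i j ↔ j.val = i.val + 1 ∨ i.val = j.val + 1 ∨
      (i.val = 0 ∧ j.val + 1 = k) ∨ (j.val = 0 ∧ i.val + 1 = k) := by
  obtain ⟨m, rfl⟩ : ∃ m, k = m + 2 := ⟨k - 2, by omega⟩
  rw [cycleGraph_adj, Fin.ext_iff, Fin.ext_iff, Fin.sub_def, Fin.sub_def]
  have e : ((1 : Fin (m+2)) : ℕ) = 1 := rfl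
  have hi := i.isLt
  have hj := j.isLt
  have key : ∀ a b : ℕ, a < m + 2 → b < m + 2 →
      ((m + 2 - b + a) % (m + 2) = 1 ↔ a = b + 1 ∨ a = 0 ∧ b + 1 = m + 2) := by
    intro a b ha hb
    by_cases hab : b ≤ a
    · rw [show m + 2 - b + a = (a - b) + (m + 2) by omega, Nat.add_mod_right,
        Nat.mod_eq_of_lt (by omega)]
      omega
    · rw [Nat.mod_eq_of_lt (by omega)]
      omega
  simp only [e]
  rw [key _ _ hi hj, key _ _ hj hi]
  tauto

namespace NonlinearPairOn

variable {S X Y A B : Set V} {x₁ x₂ y₁ y₂ a₁ a₂ b₁ b₂ : V}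

/-- Two hole vertices in `X` would be consecutive. The hole neighbour on either side of them sees
only one of the two, so it lies in `Y`. These two outer neighbours are then adjacent, which forces
the cycle to have length four. -/
theorem hole_subsingleton (h : G.NonlinearPairOn S X Y x₁ x₂ y₁ y₂) {k : ℕ} (hk : 5 ≤ k)
    (f : cycleGraph k ↪g G) (hf : ∀ i, f i ∈ S) {i j : Fin k} (hi : f i ∈ X) (hj : f j ∈ X) :
    i = j := by
  by_contra hij
  have adj : ∀ u v, G.Adj (f u) (f v) ↔ (cycleGraph k).Adj u v := fun u v => f.map_adj_iff
  have hadj := (adj i j).1 (h.clique_left _ hi _ hj (fun e => hij (f.injective e)))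
  have key : ∀ i j, f i ∈ X → f j ∈ X → ∀ u, u ≠ j → (cycleGraph k).Adj u i →
      ¬ (cycleGraph k).Adj u j → f u ∈ Y := by
    intro i j hi hj u huj hui hnuj
    by_contra hY
    have hX : f u ∉ X := fun e => hnuj ((adj u j).1 (h.clique_left _ e _ hj
      (fun e => huj (f.injective e))))
    exact hnuj ((adj u j).1 (h.hom_left _ (hf u) hX hY _ hi _ hj ((adj u i).2 hui)))
  have main : ∀ i j : Fin k, f i ∈ X → f j ∈ X → (j.val = i.val + 1 ∨ i.val + 1 = k ∧ j.val = 0) →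
      False := by
    intro i j hi hj hs
    obtain ⟨p, hp⟩ : ∃ p : Fin k, i.val = p.val + 1 ∨ i.val = 0 ∧ p.val + 1 = k := by
      by_cases h0 : i.val = 0
      · exact ⟨⟨k - 1, by omega⟩, Or.inr ⟨h0, by simp; omega⟩⟩
      · exact ⟨⟨i.val - 1, by omega⟩, Or.inl (by simp; omega)⟩
    obtain ⟨q, hq⟩ : ∃ q : Fin k, q.val = j.val + 1 ∨ q.val = 0 ∧ j.val + 1 = k := by
      by_cases h0 : j.val + 1 = k
      · exact ⟨⟨0, by omega⟩, Or.inr ⟨rfl, h0⟩⟩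
      · exact ⟨⟨j.val + 1, by omega⟩, Or.inl rfl⟩
    have hpY : f p ∈ Y := key i j hi hj p (by intro e; subst e; omega)
      (by rw [cycleGraph_adj_val (by omega)]; omega)
      (by rw [cycleGraph_adj_val (by omega)]; omega)
    have hqY : f q ∈ Y := key j i hj hi q (by intro e; subst e; omega)
      (by rw [cycleGraph_adj_val (by omega)]; omega)
      (by rw [cycleGraph_adj_val (by omega)]; omega)
    have hpq : p ≠ q := by intro e; subst e; omega
    have := (adj p q).1 (h.clique_right _ hpY _ hqY (fun e => hpq (f.injective e)))
    rw [cycleGraph_adj_val (by omega)] at this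
    omega
  rw [cycleGraph_adj_val (by omega)] at hadj
  rcases hadj with h1 | h1 | h1 | h1
  · exact main i j hi hj (Or.inl h1)
  · exact main j i hj hi (Or.inl h1)
  · exact main j i hj hi (Or.inr ⟨h1.2, h1.1⟩)
  · exact main i j hi hj (Or.inr ⟨h1.2, h1.1⟩)

/-- Shrinking a nonlinear pair preserves the lengths of the holes with at least five vertices. -/
theorem hasHoleOn_shrink (h : G.NonlinearPairOn S X Y x₁ x₂ y₁ y₂) {k : ℕ} (hk : 5 ≤ k)
    (hS : G.HasHoleOn S k) : G.HasHoleOn (shrink S X Y x₁ y₁ y₂) k := by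
  classical
  obtain ⟨hk4, f, hf⟩ := hS
  have uX : ∀ {i j}, f i ∈ X → f j ∈ X → i = j := fun hi hj => h.hole_subsingleton hk f hf hi hj
  have uY : ∀ {i j}, f i ∈ Y → f j ∈ Y → i = j := fun hi hj =>
    h.swap.hole_subsingleton hk f hf hi hj
  have adj : ∀ u v, G.Adj (f u) (f v) ↔ (cycleGraph k).Adj u v := fun u v => f.map_adj_iff
  -- The hole has at most one vertex in each of `X` and `Y`. Take `y₁` if these are adjacent and
  -- `y₂` otherwise, so that `x₁` and `y` imitate them; if one of them is missing, the choice does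
  -- not matter.
  obtain ⟨y, hyY, hys, hy⟩ : ∃ y ∈ Y, (y = y₁ ∨ y = y₂) ∧
      ∀ i j, f i ∈ X → f j ∈ Y → (G.Adj x₁ y ↔ (cycleGraph k).Adj i j) := by
    by_cases hex : ∃ i j, f i ∈ X ∧ f j ∈ Y ∧ (cycleGraph k).Adj i j
    · obtain ⟨i, j, hi, hj, hij⟩ := hex
      refine ⟨y₁, h.mem_y₁, Or.inl rfl, fun i' j' hi' hj' => ?_⟩
      rw [uX hi' hi, uY hj' hj]
      exact ⟨fun _ => hij, fun _ => h.adj₁⟩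
    · refine ⟨y₂, h.mem_y₂, Or.inr rfl, fun i' j' hi' hj' => ?_⟩
      exact ⟨fun e => absurd e h.not_adj₁, fun e => absurd ⟨i', j', hi', hj', e⟩ hex⟩
  let g : Fin k → V := fun i => if f i ∈ X then x₁ else if f i ∈ Y then y else f i
  have gX : ∀ i, f i ∈ X → g i = x₁ := fun i hi => by simp [g, hi]
  have gY : ∀ i, f i ∈ Y → g i = y := fun i hi => by
    simp [g, hi, show f i ∉ X from fun e => h.disjoint _ e hi]
  have gO : ∀ i, f i ∉ X → f i ∉ Y → g i = f i := fun i hi hi' => by simp [g, hi, hi']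
  have hxY : x₁ ∉ Y := h.disjoint _ h.mem_x₁
  have hyX : y ∉ X := fun e => h.disjoint _ e hyY
  have cases3 : ∀ i, f i ∈ X ∧ f i ∉ Y ∨ f i ∉ X ∧ f i ∈ Y ∨ f i ∉ X ∧ f i ∉ Y := fun i => by
    have := h.disjoint (f i)
    tauto
  have gadj : ∀ i j, i ≠ j → (G.Adj (g i) (g j) ↔ (cycleGraph k).Adj i j) := by
    intro i j hij
    rcases cases3 i with hi | hi | hi <;> rcases cases3 j with hj | hj | hj
    · exact absurd (uX hi.1 hj.1) hij
    · rw [gX i hi.1, gY j hj.2]; exact hy i j hi.1 hj.2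
    · rw [gX i hi.1, gO j hj.1 hj.2, ← adj, G.adj_comm, G.adj_comm (f i)]
      have := h.hom_left _ (hf j) hj.1 hj.2
      exact ⟨this _ h.mem_x₁ _ hi.1, this _ hi.1 _ h.mem_x₁⟩
    · rw [gY i hi.2, gX j hj.1, G.adj_comm, (cycleGraph k).adj_comm]; exact hy j i hj.1 hi.2
    · exact absurd (uY hi.2 hj.2) hij
    · rw [gY i hi.2, gO j hj.1 hj.2, ← adj, G.adj_comm, G.adj_comm (f i)]
      have := h.hom_right _ (hf j) hj.1 hj.2
      exact ⟨this _ hyY _ hi.2, this _ hi.2 _ hyY⟩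
    · rw [gO i hi.1 hi.2, gX j hj.1, ← adj]
      have := h.hom_left _ (hf i) hi.1 hi.2
      exact ⟨this _ h.mem_x₁ _ hj.1, this _ hj.1 _ h.mem_x₁⟩
    · rw [gO i hi.1 hi.2, gY j hj.2, ← adj]
      have := h.hom_right _ (hf i) hi.1 hi.2
      exact ⟨this _ hyY _ hj.2, this _ hj.2 _ hyY⟩
    · rw [gO i hi.1 hi.2, gO j hj.1 hj.2, adj]
  have ginj : Function.Injective g := by
    intro i j hij
    rcases cases3 i with hi | hi | hi <;> rcases cases3 j with hj | hj | hj
    · exact uX hi.1 hj.1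
    · rw [gX i hi.1, gY j hj.2] at hij; exact absurd (hij ▸ h.mem_x₁) hyX
    · rw [gX i hi.1, gO j hj.1 hj.2] at hij; exact absurd (hij ▸ h.mem_x₁) hj.1
    · rw [gY i hi.2, gX j hj.1] at hij; exact absurd (hij ▸ h.mem_x₁) hyX
    · exact uY hi.2 hj.2
    · rw [gY i hi.2, gO j hj.1 hj.2] at hij; exact absurd (hij ▸ hyY) hj.2
    · rw [gO i hi.1 hi.2, gX j hj.1] at hij; exact absurd (hij ▸ h.mem_x₁) hi.1
    · rw [gO i hi.1 hi.2, gY j hj.2] at hij; exact absurd (hij ▸ hyY) hi.2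
    · rw [gO i hi.1 hi.2, gO j hj.1 hj.2] at hij; exact f.injective hij
  refine ⟨hk4, ⟨⟨g, ginj⟩, ?_⟩, ?_⟩
  · intro i j
    by_cases hij : i = j
    · subst hij; simp
    · exact gadj i j hij
  · intro i
    show g i ∈ _
    rcases cases3 i with hi | hi | hi
    · rw [gX i hi.1]; exact Or.inr (Or.inl rfl)
    · rw [gY i hi.2]
      rcases hys with e | e
      exacts [Or.inr (Or.inr (Or.inl e)), Or.inr (Or.inr (Or.inr e))]
    · rw [gO i hi.1 hi.2]; exact Or.inl ⟨hf i, hi⟩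

end NonlinearPairOn
-- Induced subgraphs and the degree bound
theorem IsQuasiLine.induce (h : G.IsQuasiLine) (S : Set V) : (G.induce S).IsQuasiLine := by
  intro v
  obtain ⟨A, B, hA, hB, hd, he⟩ := h v
  refine ⟨(↑) ⁻¹' A, (↑) ⁻¹' B, ?_, ?_, hd.preimage _, ?_⟩
  · intro a ha b hb hab
    exact hA ha hb (fun e => hab (Subtype.ext e))
  · intro a ha b hb hab
    exact hB ha hb (fun e => hab (Subtype.ext e))
  · rw [← Set.preimage_union, he]; rfl

theorem HasHoleOn.induce {S : Set V} {k : ℕ} (h : G.HasHoleOn S k) : (G.induce S).HasHole k := by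
  obtain ⟨hk, f, hf⟩ := h
  exact ⟨hk, ⟨⟨⟨fun i => ⟨f i, hf i⟩, fun i j e => f.injective (congrArg Subtype.val e)⟩,
    fun {i j} => f.map_adj_iff⟩⟩⟩

theorem HasHole.on_univ {k : ℕ} (h : G.HasHole k) {S : Set V} (hS : ∀ v, v ∈ S) :
    G.HasHoleOn S k := by
  obtain ⟨hk, ⟨f⟩⟩ := h
  exact ⟨hk, f, fun i => hS _⟩

/-- Opposite vertices of the induced four-cycle are non-adjacent, so they lie in different cliques;
each clique then contains two consecutive vertices of the cycle. -/
theorem IsNonlinearHomogeneousPair.exists_on {S : Set V} {A B : Set S}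
    (h : (G.induce S).IsNonlinearHomogeneousPair A B) :
    ∃ X Y x₁ x₂ y₁ y₂, G.NonlinearPairOn S X Y x₁ x₂ y₁ y₂ := by
  obtain ⟨h, ⟨f⟩⟩ := h
  have adj : ∀ i j, G.Adj (f i).1.1 (f j).1.1 ↔ (cycleGraph 4).Adj i j := fun i j => f.map_adj_iff
  have mk : ∀ p q r s, (f p).1 ∈ A → (f q).1 ∈ A → (f r).1 ∈ B → (f s).1 ∈ B →
      (cycleGraph 4).Adj p r → (cycleGraph 4).Adj q s → ¬ (cycleGraph 4).Adj p s →
      ¬ (cycleGraph 4).Adj q r → ∃ X Y x₁ x₂ y₁ y₂, G.NonlinearPairOn S X Y x₁ x₂ y₁ y₂ := by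
    intro p q r s hp hq hr hs h1 h2 h3 h4
    refine ⟨(↑) '' A, (↑) '' B, (f p).1.1, (f q).1.1, (f r).1.1, (f s).1.1, ?_⟩
    refine ⟨?_, ?_, ?_, ?_, ?_, ?_, ?_, ⟨_, hp, rfl⟩, ⟨_, hq, rfl⟩, ⟨_, hr, rfl⟩, ⟨_, hs, rfl⟩,
      (adj _ _).2 h1, (adj _ _).2 h2, fun e => h3 ((adj _ _).1 e), fun e => h4 ((adj _ _).1 e)⟩
    · rintro _ ⟨v, -, rfl⟩; exact v.2
    · rintro _ ⟨v, -, rfl⟩; exact v.2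
    · rintro _ ⟨v, hv, rfl⟩ ⟨w, hw, e⟩
      rw [Subtype.ext e] at hw
      exact Set.disjoint_left.1 h.disjoint hv hw
    · rintro _ ⟨v, hv, rfl⟩ _ ⟨w, hw, rfl⟩ hne
      exact h.clique_left hv hw (fun e => hne (congrArg _ e))
    · rintro _ ⟨v, hv, rfl⟩ _ ⟨w, hw, rfl⟩ hne
      exact h.clique_right hv hw (fun e => hne (congrArg _ e))
    · rintro v hvS hvA hvB _ ⟨a, ha, rfl⟩ _ ⟨b, hb, rfl⟩ hab
      rcases h.homogeneous_left ⟨v, hvS⟩ (by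
        rintro (e | e)
        exacts [hvA ⟨_, e, rfl⟩, hvB ⟨_, e, rfl⟩]) with h5 | h5
      exacts [h5 _ hb, absurd hab (h5 _ ha)]
    · rintro v hvS hvA hvB _ ⟨a, ha, rfl⟩ _ ⟨b, hb, rfl⟩ hab
      rcases h.homogeneous_right ⟨v, hvS⟩ (by
        rintro (e | e)
        exacts [hvA ⟨_, e, rfl⟩, hvB ⟨_, e, rfl⟩]) with h5 | h5
      exacts [h5 _ hb, absurd hab (h5 _ ha)]
  have side : ∀ i, (f i).1 ∈ A ∨ (f i).1 ∈ B := fun i => (f i).2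
  have clA : ∀ i j, i ≠ j → ¬ (cycleGraph 4).Adj i j → (f i).1 ∈ A → (f j).1 ∈ A → False := by
    intro i j hij hn hi hj
    exact hn ((adj i j).1 (h.clique_left hi hj
      (fun e => hij (f.injective (Subtype.ext e)))))
  have clB : ∀ i j, i ≠ j → ¬ (cycleGraph 4).Adj i j → (f i).1 ∈ B → (f j).1 ∈ B → False := by
    intro i j hij hn hi hj
    exact hn ((adj i j).1 (h.clique_right hi hj
      (fun e => hij (f.injective (Subtype.ext e)))))
  have n02 : ¬ (cycleGraph 4).Adj 0 2 := by decide
  have n13 : ¬ (cycleGraph 4).Adj 1 3 := by decide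
  have a02 := clA 0 2 (by decide) n02
  have a13 := clA 1 3 (by decide) n13
  have b02 := clB 0 2 (by decide) n02
  have b13 := clB 1 3 (by decide) n13
  -- Of the sixteen distributions of the cycle over the two cliques, the four that separate both
  -- opposite pairs survive.
  rcases side 0 with s0 | s0 <;> rcases side 2 with s2 | s2 <;>
    rcases side 1 with s1 | s1 <;> rcases side 3 with s3 | s3 <;>
    try first
      | exact (a02 s0 s2).elim
      | exact (a13 s1 s3).elim
      | exact (b02 s0 s2).elim
      | exact (b13 s1 s3).elim
  · exact mk 0 1 3 2 s0 s1 s3 s2 (by decide) (by decide) (by decide) (by decide)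
  · exact mk 0 3 1 2 s0 s3 s1 s2 (by decide) (by decide) (by decide) (by decide)
  · exact mk 2 1 3 0 s2 s1 s3 s0 (by decide) (by decide) (by decide) (by decide)
  · exact mk 2 3 1 0 s2 s3 s1 s0 (by decide) (by decide) (by decide) (by decide)

/-- A vertex of a clique `A` in the neighbourhood of `v` is adjacent to `v` and to the rest of `A`,
so its degree is at least `|A|`. Summing over both cliques gives `|A|² + |B|² ≤ 2m`, and `(|A| +
|B|)² ≤ 2(|A|² + |B|²)`. -/
theorem IsQuasiLine.degree_sq_le [Fintype V] [DecidableEq V] [DecidableRel G.Adj]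
    (h : G.IsQuasiLine) (v : V) : G.degree v ^ 2 ≤ 4 * G.edgeFinset.card := by
  classical
  obtain ⟨A, B, hA, hB, hd, he⟩ := h v
  have hcl : ∀ C : Set V, G.IsClique C → C ⊆ G.neighborSet v →
      C.toFinset.card ^ 2 ≤ ∑ w ∈ C.toFinset, G.degree w := by
    intro C hC hCv
    rw [sq, ← smul_eq_mul, ← Finset.sum_const]
    refine Finset.sum_le_sum fun w hw => ?_
    have hwC : w ∈ C := by simpa using hw
    have : insert v (C.toFinset.erase w) ⊆ G.neighborFinset w := by
      intro u hu
      rw [mem_neighborFinset]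
      rcases Finset.mem_insert.1 hu with rfl | hu
      · exact (hCv hwC).symm
      · have := Finset.mem_erase.1 hu
        exact hC hwC (by simpa using this.2) this.1.symm
    have h2 := Finset.card_le_card this
    rw [Finset.card_insert_of_notMem (fun e => (hCv (by simpa using (Finset.mem_erase.1 e).2) :
      G.Adj v v).ne rfl), Finset.card_erase_of_mem hw] at h2
    simp only [card_neighborFinset_eq_degree] at h2
    omega
  have h1 := hcl A hA (he ▸ Set.subset_union_left)
  have h2 := hcl B hB (he ▸ Set.subset_union_right)
  have hdis : Disjoint A.toFinset B.toFinset := Set.disjoint_toFinset.2 hd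
  have hun : G.neighborFinset v = A.toFinset ∪ B.toFinset := by
    ext w
    have := Set.ext_iff.1 he w
    simp only [mem_neighborFinset, Finset.mem_union, Set.mem_toFinset]
    exact this.symm
  have hdeg : G.degree v = A.toFinset.card + B.toFinset.card := by
    rw [← card_neighborFinset_eq_degree, hun, Finset.card_union_of_disjoint hdis]
  have hsum : ∑ w ∈ A.toFinset, G.degree w + ∑ w ∈ B.toFinset, G.degree w ≤
      2 * G.edgeFinset.card := by
    rw [← Finset.sum_union hdis, ← sum_degrees_eq_twice_card_edges]
    exact Finset.sum_le_sum_of_subset (Finset.subset_univ _)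
  rw [hdeg]
  nlinarith [sq_nonneg ((A.toFinset.card : ℤ) - B.toFinset.card), two_mul_le_add_sq A.toFinset.card B.toFinset.card]
end SimpleGraph

namespace RAM

/-! ### Runs without a word size, and the word size of tame programs -/

/-- `Exec p σ τ t`: started with memory `σ`, the program `p` halts after exactly `t` steps with
memory `τ`. -/
inductive Exec : Program → Mem → Mem → ℕ → Prop
  | skip (σ : Mem) : Exec .skip σ σ 1
  | assign (σ : Mem) (a : ℕ) (i e : Expr) :
      Exec (.assign a i e) σ (σ.store a (i.eval σ) (e.eval σ)) (i.cost + e.cost + 1)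
  | seq {p q : Program} {σ τ υ : Mem} {s t : ℕ} (hp : Exec p σ τ s) (hq : Exec q τ υ t) :
      Exec (.seq p q) σ υ (s + t)
  | iteTrue {c : Expr} {p q : Program} {σ τ : Mem} {t : ℕ}
      (h : c.eval σ ≠ 0) (hp : Exec p σ τ t) : Exec (.ite c p q) σ τ (c.cost + 1 + t)
  | iteFalse {c : Expr} {p q : Program} {σ τ : Mem} {t : ℕ}
      (h : c.eval σ = 0) (hq : Exec q σ τ t) : Exec (.ite c p q) σ τ (c.cost + 1 + t)
  | loopDone {c : Expr} {p : Program} {σ : Mem} (h : c.eval σ = 0) :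
      Exec (.loop c p) σ σ (c.cost + 1)
  | loopStep {c : Expr} {p : Program} {σ τ υ : Mem} {s t : ℕ}
      (h : c.eval σ ≠ 0) (hp : Exec p σ τ s) (hl : Exec (.loop c p) τ υ t) :
      Exec (.loop c p) σ υ (c.cost + 1 + s + t)

namespace Expr

/-- The number of leaves that count for the size of the value. -/
def rank : Expr → ℕ
  | lit _ => 1
  | get _ i => i.rank
  | add e f => e.rank + f.rank
  | sub e f => e.rank + f.rank
  | mul e f => e.rank + f.rank

/-- The largest literal. -/
def litMax : Expr → ℕ
  | lit k => k
  | get _ i => i.litMax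
  | add e f => max e.litMax f.litMax
  | sub e f => max e.litMax f.litMax
  | mul e f => max e.litMax f.litMax

/-- Expressions whose value exceeds the largest memory entry by at most `3`. -/
def slow : Expr → Bool
  | lit k => k ≤ 3
  | get _ _ => true
  | add (get _ _) (lit k) => k ≤ 3
  | sub (lit k) _ => k ≤ 3
  | _ => false

theorem rank_pos (e : Expr) : 1 ≤ e.rank := by
  induction e <;> simp_all [rank] <;> omega

/-- Sums are absorbed by products because all the bounds `B ^ rank` are at least `2`; the rank
therefore acts as a degree. -/
theorem fits_of_le {B W : ℕ} {σ : Mem} (hB : 2 ≤ B) (hσ : ∀ a i, σ a i ≤ B) (e : Expr)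
    (hl : e.litMax ≤ B) (hW : B ^ e.rank ≤ W) : e.Fits W σ ∧ e.eval σ ≤ B ^ e.rank := by
  have pw : ∀ {a b : ℕ}, a ≤ b → B ^ a ≤ B ^ b := fun h => Nat.pow_le_pow_right (by omega) h
  have two : ∀ e : Expr, 2 ≤ B ^ e.rank := fun e =>
    hB.trans ((pow_one B).symm.le.trans (pw e.rank_pos))
  induction e with
  | lit k =>
    simp only [litMax, rank, pow_one] at hl hW ⊢
    exact ⟨hl.trans hW, hl⟩
  | get a i ih =>
    have h1 := ih hl hW
    have h2 : σ a (i.eval σ) ≤ B ^ i.rank :=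
      (hσ _ _).trans ((pow_one B).symm.le.trans (pw i.rank_pos))
    exact ⟨⟨h1.1, h2.trans hW⟩, h2⟩
  | add e f he hf =>
    simp only [litMax, rank, max_le_iff] at hl hW ⊢
    have h1 := he hl.1 ((pw (Nat.le_add_right _ _)).trans hW)
    have h2 := hf hl.2 ((pw (Nat.le_add_left _ _)).trans hW)
    have h3 : e.eval σ + f.eval σ ≤ B ^ (e.rank + f.rank) := by
      rw [pow_add]
      exact (Nat.add_le_add h1.2 h2.2).trans (add_le_mul (two e) (two f))
    exact ⟨⟨h1.1, h2.1, h3.trans hW⟩, h3⟩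
  | sub e f he hf =>
    simp only [litMax, rank, max_le_iff] at hl hW ⊢
    have h1 := he hl.1 ((pw (Nat.le_add_right _ _)).trans hW)
    have h2 := hf hl.2 ((pw (Nat.le_add_left _ _)).trans hW)
    have h3 : e.eval σ - f.eval σ ≤ B ^ (e.rank + f.rank) :=
      (Nat.sub_le _ _).trans (h1.2.trans (pw (Nat.le_add_right _ _)))
    exact ⟨⟨h1.1, h2.1, h3.trans hW⟩, h3⟩
  | mul e f he hf =>
    simp only [litMax, rank, max_le_iff] at hl hW ⊢
    have h1 := he hl.1 ((pw (Nat.le_add_right _ _)).trans hW)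
    have h2 := hf hl.2 ((pw (Nat.le_add_left _ _)).trans hW)
    have h3 : e.eval σ * f.eval σ ≤ B ^ (e.rank + f.rank) := by
      rw [pow_add]
      exact Nat.mul_le_mul h1.2 h2.2
    exact ⟨⟨h1.1, h2.1, h3.trans hW⟩, h3⟩

theorem eval_le_of_slow {M : ℕ} {σ : Mem} (hσ : ∀ a i, σ a i ≤ M) (e : Expr) (he : e.slow = true) :
    e.eval σ ≤ M + 3 := by
  unfold slow at he
  split at he
  · simp only [decide_eq_true_eq] at he
    simp only [eval]; omega
  · exact (hσ _ _).trans (by omega)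
  · simp only [decide_eq_true_eq] at he
    simp only [eval]
    exact Nat.add_le_add (hσ _ _) he
  · simp only [decide_eq_true_eq] at he
    simp only [eval]; omega
  · simp at he

end Expr

namespace Program

/-- All expressions have rank at most `w` and literals at most `3`, and only slow expressions are
stored. -/
def tame (w : ℕ) : Program → Bool
  | skip => true
  | assign _ i e => i.rank ≤ w && i.litMax ≤ 3 && e.rank ≤ w && e.litMax ≤ 3 && e.slow
  | seq p q => p.tame w && q.tame w
  | ite c p q => c.rank ≤ w && c.litMax ≤ 3 && p.tame w && q.tame w
  | loop c p => c.rank ≤ w && c.litMax ≤ 3 && p.tame w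

/-- The arrays that a program may change. -/
def writes : Program → List ℕ
  | skip => []
  | assign a _ _ => [a]
  | seq p q => p.writes ++ q.writes
  | ite _ p q => p.writes ++ q.writes
  | loop _ p => p.writes

end Program

theorem Mem.store_of_ne {σ : Mem} {a b : ℕ} (h : b ≠ a) (i x : ℕ) : σ.store a i x b = σ b :=
  Function.update_of_ne h _ _

theorem Mem.store_self (σ : Mem) (a i x : ℕ) :
    σ.store a i x a = Function.update (σ a) i x :=
  Function.update_self _ _ _

theorem Mem.store_self_apply (σ : Mem) (a i x j : ℕ) :
    σ.store a i x a j = if j = i then x else σ a j := by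
  rw [Mem.store_self, Function.update_apply]

theorem Mem.store_le {σ : Mem} {M M' x : ℕ} (hσ : ∀ a i, σ a i ≤ M) (hx : x ≤ M') (hM : M ≤ M')
    (a i : ℕ) : ∀ b j, σ.store a i x b j ≤ M' := by
  intro b j
  by_cases hb : b = a
  · subst hb
    rw [Mem.store_self_apply]
    split
    exacts [hx, (hσ _ _).trans hM]
  · rw [Mem.store_of_ne hb]
    exact (hσ _ _).trans hM

/-- An assignment raises the largest memory entry by at most `3` and takes at least one step, so `M
+ 3 * t` bounds every stored value. Intermediate values are then at most `B ^ w`, and a time bound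
yields a word-size bound. -/
theorem Exec.runs {w W B : ℕ} {p : Program} {σ τ : Mem} {t : ℕ} (h : Exec p σ τ t)
    (hp : p.tame w = true) (hW : B ^ w ≤ W) (M : ℕ) (hσ : ∀ a i, σ a i ≤ M)
    (hB : M + 3 * t + 3 ≤ B) : Runs W p σ τ t ∧ ∀ a i, τ a i ≤ M + 3 * t := by
  have fits : ∀ (M : ℕ) (σ : Mem), (∀ a i, σ a i ≤ M) → M + 3 ≤ B → ∀ e : Expr,
      e.rank ≤ w → e.litMax ≤ 3 → e.Fits W σ := fun M σ hσ hM e h1 h2 =>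
    (e.fits_of_le (by omega) (fun a i => (hσ a i).trans (by omega)) (by omega)
      ((Nat.pow_le_pow_right (by omega) h1).trans hW)).1
  induction h generalizing M with
  | skip σ => exact ⟨.skip σ, fun a i => (hσ a i).trans (by omega)⟩
  | assign σ a i e =>
    simp only [Program.tame, Bool.and_eq_true, decide_eq_true_eq] at hp
    obtain ⟨⟨⟨⟨h1, h2⟩, h3⟩, h4⟩, h5⟩ := hp
    refine ⟨.assign σ a i e (fits M σ hσ (by omega) i h1 h2) (fits M σ hσ (by omega) e h3 h4), ?_⟩
    exact Mem.store_le hσ ((e.eval_le_of_slow hσ h5).trans (by omega)) (by omega) _ _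
  | seq _ _ ih₁ ih₂ =>
    simp only [Program.tame, Bool.and_eq_true] at hp
    obtain ⟨r₁, b₁⟩ := ih₁ hp.1 M hσ (by omega)
    obtain ⟨r₂, b₂⟩ := ih₂ hp.2 _ b₁ (by omega)
    exact ⟨.seq r₁ r₂, fun a i => (b₂ a i).trans (by omega)⟩
  | iteTrue h _ ih =>
    simp only [Program.tame, Bool.and_eq_true, decide_eq_true_eq] at hp
    obtain ⟨⟨⟨h1, h2⟩, h3⟩, h4⟩ := hp
    obtain ⟨r, b⟩ := ih h3 M hσ (by omega)
    exact ⟨.iteTrue (fits M _ hσ (by omega) _ h1 h2) h r, fun a i => (b a i).trans (by omega)⟩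
  | iteFalse h _ ih =>
    simp only [Program.tame, Bool.and_eq_true, decide_eq_true_eq] at hp
    obtain ⟨⟨⟨h1, h2⟩, h3⟩, h4⟩ := hp
    obtain ⟨r, b⟩ := ih h4 M hσ (by omega)
    exact ⟨.iteFalse (fits M _ hσ (by omega) _ h1 h2) h r, fun a i => (b a i).trans (by omega)⟩
  | loopDone h =>
    simp only [Program.tame, Bool.and_eq_true, decide_eq_true_eq] at hp
    exact ⟨.loopDone (fits M _ hσ (by omega) _ hp.1.1 hp.1.2) h,
      fun a i => (hσ a i).trans (by omega)⟩
  | loopStep h _ _ ih₁ ih₂ =>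
    have hp' := hp
    simp only [Program.tame, Bool.and_eq_true, decide_eq_true_eq] at hp'
    obtain ⟨r₁, b₁⟩ := ih₁ hp'.2 M hσ (by omega)
    obtain ⟨r₂, b₂⟩ := ih₂ hp _ b₁ (by omega)
    exact ⟨.loopStep (fits M _ hσ (by omega) _ hp'.1.1 hp'.1.2) h r₁ r₂,
      fun a i => (b₂ a i).trans (by omega)⟩

theorem Exec.frame {p : Program} {σ τ : Mem} {t : ℕ} (h : Exec p σ τ t) :
    ∀ a, a ∉ p.writes → τ a = σ a := by
  induction h with
  | skip | loopDone => intros; rfl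
  | assign σ a i e =>
    intro b hb
    exact Mem.store_of_ne (by simpa [Program.writes] using hb) _ _
  | seq _ _ ih₁ ih₂ =>
    intro b hb
    simp only [Program.writes, List.mem_append, not_or] at hb
    rw [ih₂ b hb.2, ih₁ b hb.1]
  | iteTrue _ _ ih =>
    intro b hb
    simp only [Program.writes, List.mem_append, not_or] at hb
    exact ih b hb.1
  | iteFalse _ _ ih =>
    intro b hb
    simp only [Program.writes, List.mem_append, not_or] at hb
    exact ih b hb.2
  | loopStep _ _ _ ih₁ ih₂ =>
    intro b hb
    rw [ih₂ b hb, ih₁ b hb]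

/-! ### Weakest preconditions -/

/-- Started with memory `σ`, the program `p` halts, and its final memory and its number of steps
satisfy `Q`. -/
def WP (p : Program) (σ : Mem) (Q : Mem → ℕ → Prop) : Prop :=
  ∃ τ t, Exec p σ τ t ∧ Q τ t

/-- The frame condition is supplied with the postcondition, so specifications need not list the
arrays that stay unchanged. -/
theorem WP.mono {p : Program} {σ : Mem} {Q Q' : Mem → ℕ → Prop} (h : WP p σ Q)
    (hQ : ∀ τ t, (∀ a, a ∉ p.writes → τ a = σ a) → Q τ t → Q' τ t) : WP p σ Q' := by
  obtain ⟨τ, t, e, hq⟩ := h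
  exact ⟨τ, t, e, hQ τ t e.frame hq⟩

theorem wp_skip {σ : Mem} {Q : Mem → ℕ → Prop} : WP .skip σ Q ↔ Q σ 1 :=
  ⟨fun ⟨_, _, e, h⟩ => by cases e; exact h, fun h => ⟨_, _, .skip σ, h⟩⟩

theorem wp_assign {σ : Mem} {Q : Mem → ℕ → Prop} {a : ℕ} {i e : Expr} :
    WP (.assign a i e) σ Q ↔ Q (σ.store a (i.eval σ) (e.eval σ)) (i.cost + e.cost + 1) :=
  ⟨fun ⟨_, _, e, h⟩ => by cases e; exact h, fun h => ⟨_, _, .assign σ a i e, h⟩⟩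

theorem wp_seq {σ : Mem} {Q : Mem → ℕ → Prop} {p q : Program} :
    WP (.seq p q) σ Q ↔ WP p σ fun τ t => WP q τ fun υ s => Q υ (t + s) := by
  constructor
  · rintro ⟨_, _, e, h⟩
    cases e with
    | seq hp hq => exact ⟨_, _, hp, _, _, hq, h⟩
  · rintro ⟨_, _, hp, _, _, hq, h⟩
    exact ⟨_, _, .seq hp hq, h⟩

theorem wp_ite {σ : Mem} {Q : Mem → ℕ → Prop} {c : Expr} {p q : Program} :
    WP (.ite c p q) σ Q ↔
      (c.eval σ ≠ 0 → WP p σ fun τ t => Q τ (c.cost + 1 + t)) ∧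
      (c.eval σ = 0 → WP q σ fun τ t => Q τ (c.cost + 1 + t)) := by
  constructor
  · rintro ⟨_, _, e, h⟩
    cases e with
    | iteTrue hc hp => exact ⟨fun _ => ⟨_, _, hp, h⟩, fun h' => absurd h' hc⟩
    | iteFalse hc hp => exact ⟨fun h' => absurd hc h', fun _ => ⟨_, _, hp, h⟩⟩
  · rintro ⟨h1, h2⟩
    by_cases hc : c.eval σ = 0
    · obtain ⟨_, _, hp, h⟩ := h2 hc
      exact ⟨_, _, .iteFalse hc hp, h⟩
    · obtain ⟨_, _, hp, h⟩ := h1 hc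
      exact ⟨_, _, .iteTrue hc hp, h⟩

/-- A loop with invariant `I`, at most `N` iterations, counted down by `f`, and at most `T` steps
for each iteration. -/
theorem wp_loop {c : Expr} {p : Program} {Q : Mem → ℕ → Prop} (T : ℕ) (I : Mem → Prop)
    (f : Mem → ℕ) (hs : ∀ τ, I τ → c.eval τ ≠ 0 → WP p τ fun υ s => s ≤ T ∧ I υ ∧ f υ < f τ)
    {σ : Mem} (h : I σ) (hQ : ∀ τ t, I τ → c.eval τ = 0 → 
      t ≤ f σ * (T + c.cost + 1) + c.cost + 1 → Q τ t) : WP (.loop c p) σ Q := by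
  have key : ∀ N σ, f σ ≤ N → I σ → ∃ τ t, Exec (.loop c p) σ τ t ∧ I τ ∧ c.eval τ = 0 ∧
      t ≤ N * (T + c.cost + 1) + c.cost + 1 := by
    intro N
    induction N with
    | zero =>
      intro σ hf hI
      by_cases hc : c.eval σ = 0
      · exact ⟨σ, _, .loopDone hc, hI, hc, by omega⟩
      · obtain ⟨_, _, _, _, _, h⟩ := hs σ hI hc
        omega
    | succ N ih =>
      intro σ hf hI
      by_cases hc : c.eval σ = 0
      · exact ⟨σ, _, .loopDone hc, hI, hc, by omega⟩
      · obtain ⟨υ, s, e, hsT, hυ, hlt⟩ := hs σ hI hc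
        obtain ⟨τ, t, e', hτ, hc', ht⟩ := ih υ (by omega) hυ
        exact ⟨τ, _, .loopStep hc e e', hτ, hc', by rw [Nat.add_mul]; omega⟩
  obtain ⟨τ, t, e, h1, h2, h3⟩ := key _ σ le_rfl h
  exact ⟨τ, t, e, hQ τ t h1 h2 h3⟩

/-- The scalar variable `a`. -/
abbrev var (a : ℕ) : Expr := .get a (.lit 0)

/-- Assignment to the scalar variable `a`. -/
abbrev setVar (a : ℕ) (e : Expr) : Program := .assign a (.lit 0) e

/-- `for i < b do p`. -/
def forLoop (i : ℕ) (b : Expr) (p : Program) : Program :=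
  .seq (setVar i (.lit 0))
    (.loop (.sub b (var i)) (.seq p (setVar i (.add (var i) (.lit 1)))))

/-- A counting loop with `N` iterations, invariant `I` and at most `T` steps for each iteration. -/
theorem wp_forLoop {i : ℕ} {b : Expr} {p : Program} {σ : Mem} {Q : Mem → ℕ → Prop} (N T : ℕ)
    (I : ℕ → Mem → Prop) (hi : i ∉ p.writes)
    (hb : ∀ τ, (∀ a, a ∉ i :: p.writes → τ a = σ a) → b.eval τ = N)
    (hI : ∀ k τ x, I k τ → I k (τ.store i 0 x)) (h0 : I 0 σ)
    (hs : ∀ k < N, ∀ τ, (∀ a, a ∉ i :: p.writes → τ a = σ a) → τ i 0 = k → I k τ →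
      WP p τ fun υ s => s ≤ T ∧ I (k + 1) υ)
    (hQ : ∀ τ t, (∀ a, a ∉ i :: p.writes → τ a = σ a) → I N τ →
      t ≤ N * (T + b.cost + 10) + b.cost + 7 → Q τ t) : WP (forLoop i b p) σ Q := by
  rw [forLoop, wp_seq, wp_assign]
  simp only [Expr.eval, Expr.cost]
  refine wp_loop (T + 6) (fun τ => (∀ a, a ∉ i :: p.writes → τ a = σ a) ∧ τ i 0 ≤ N ∧ I (τ i 0) τ)
    (fun τ => N - τ i 0) ?_ ?_ ?_
  · rintro τ ⟨hfr, hle, hτ⟩ hc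
    simp only [Expr.eval] at hc
    rw [hb τ hfr] at hc
    rw [wp_seq]
    refine (hs _ (by omega) τ hfr rfl hτ).mono fun υ s hfr' hυ => ?_
    rw [wp_assign]
    simp only [Expr.eval, Expr.cost]
    have hυi : υ i = τ i := hfr' i hi
    rw [hυi]
    have hsT := hυ.1
    refine ⟨by omega, ⟨?_, ?_, ?_⟩, ?_⟩
    · intro a ha
      simp only [List.mem_cons, not_or] at ha
      rw [Mem.store_of_ne ha.1, hfr' a ha.2]
      exact hfr a (by simp [ha.1, ha.2])
    · rw [Mem.store_self_apply, if_pos rfl]; omega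
    · rw [Mem.store_self_apply, if_pos rfl]; exact hI _ _ _ hυ.2
    · rw [Mem.store_self_apply, if_pos rfl]; omega
  · refine ⟨?_, ?_, ?_⟩
    · intro a ha
      simp only [List.mem_cons, not_or] at ha
      rw [Mem.store_of_ne ha.1]
    · rw [Mem.store_self_apply, if_pos rfl]; omega
    · rw [Mem.store_self_apply, if_pos rfl]; exact hI _ _ _ h0
  · rintro τ t ⟨hfr, hle, hτ⟩ hc ht
    simp only [Expr.eval] at hc
    rw [hb τ hfr] at hc
    rw [Mem.store_self_apply, if_pos rfl] at ht
    refine hQ _ _ hfr ?_ ?_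
    · rwa [show N = τ i 0 by omega]
    · simp only [Expr.cost, Nat.sub_zero] at ht
      have : T + 6 + (b.cost + (1 + 1) + 1) + 1 = T + b.cost + 10 := by omega
      rw [this] at ht
      omega

end RAM


namespace SimpleGraph

/-! ### The forced closure of an induced four-cycle -/

variable {V : Type*} {G : SimpleGraph V}

/-- `v` is adjacent to `p`, but neither equal nor adjacent to `q`. -/
def SeesOnly (G : SimpleGraph V) (p q v : V) : Prop :=
  G.Adj p v ∧ ¬ (q = v ∨ G.Adj q v)

/-- The state of the closure computation that starts from the four-cycle `x₁ x₂ y₂ y₁`: a queue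
`Q` of vertices and the side (`1` or `2`, and `0` outside the queue) of every vertex. -/
structure ClosureState (G : SimpleGraph V) (S : Set V) (x₁ x₂ y₁ y₂ : V) (Q : List V)
    (sd : V → ℕ) : Prop where
  nodup : Q.Nodup
  mem_iff : ∀ v, v ∈ Q ↔ sd v ≠ 0
  side_le : ∀ v, sd v ≤ 2
  subset : ∀ v ∈ Q, v ∈ S
  side_x₁ : sd x₁ = 1
  side_x₂ : sd x₂ = 1
  side_y₁ : sd y₁ = 2
  side_y₂ : sd y₂ = 2
  forced : ∀ X Y, G.NonlinearPairOn S X Y x₁ x₂ y₁ y₂ → ∀ v, (sd v = 1 → v ∈ X) ∧ (sd v = 2 → v ∈ Y)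

/-- The vertices in `P` have been processed. -/
structure Processed (G : SimpleGraph V) (S : Set V) (x₁ y₁ : V) (P : List V) (sd : V → ℕ) :
    Prop where
  clique : ∀ u ∈ P, ∀ w ∈ P, u ≠ w → sd u = sd w → G.Adj u w
  closed : ∀ u ∈ P, ∀ r, (sd u = 1 ∧ r = x₁ ∨ sd u = 2 ∧ r = y₁) → ∀ v ∈ S,
    G.SeesOnly u r v ∨ G.SeesOnly r u v → sd v ≠ 0

variable {S : Set V} {x₁ x₂ y₁ y₂ : V} {Q P : List V} {sd : V → ℕ}

/-- The forcing rule: a vertex of `X` equals or sees `q`, and a vertex outside the pair cannot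
separate `p` from `q`. -/
theorem NonlinearPairOn.mem_right_of_seesOnly {X Y : Set V}
    (h : G.NonlinearPairOn S X Y x₁ x₂ y₁ y₂) {p q v : V} (hp : p ∈ X) (hq : q ∈ X) (hv : v ∈ S)
    (hs : G.SeesOnly p q v) : v ∈ Y := by
  by_contra hY
  by_cases hX : v ∈ X
  · exact hs.2 (or_iff_not_imp_left.2 (h.clique_left _ hq _ hX))
  · exact hs.2 (Or.inr (h.hom_left v hv hX hY _ hp _ hq hs.1.symm).symm)

theorem ClosureState.forced_of_seesOnly (h : G.ClosureState S x₁ x₂ y₁ y₂ Q sd) {p q v : V} {s : ℕ}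
    (hp : sd p = s) (hq : sd q = s) (hv : v ∈ S) (hs : G.SeesOnly p q v) (X Y : Set V)
    (hXY : G.NonlinearPairOn S X Y x₁ x₂ y₁ y₂) : (s = 2 → v ∈ X) ∧ (s = 1 → v ∈ Y) := by
  have f := h.forced X Y hXY
  constructor
  · rintro rfl; exact hXY.swap.mem_right_of_seesOnly ((f p).2 hp) ((f q).2 hq) hv hs
  · rintro rfl; exact hXY.mem_right_of_seesOnly ((f p).1 hp) ((f q).1 hq) hv hs

/-- The sides are `1` and `2`, so `3 - s` is the side opposite to `s`, where a vertex separating two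
members of side `s` is forced to go. -/
theorem ClosureState.push [DecidableEq V] (h : G.ClosureState S x₁ x₂ y₁ y₂ Q sd) {v : V} {s : ℕ}
    (hv : v ∈ S) (h0 : sd v = 0) (hs : s = 1 ∨ s = 2)
    (hf : ∀ X Y, G.NonlinearPairOn S X Y x₁ x₂ y₁ y₂ → (s = 2 → v ∈ X) ∧ (s = 1 → v ∈ Y)) :
    G.ClosureState S x₁ x₂ y₁ y₂ (Q ++ [v]) (Function.update sd v (3 - s)) := by
  have hvQ : v ∉ Q := fun e => (h.mem_iff v).1 e h0
  have hne : ∀ z, sd z ≠ 0 → Function.update sd v (3 - s) z = sd z := fun z hz =>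
    Function.update_of_ne (by rintro rfl; exact hz h0) _ _
  refine ⟨?_, ?_, ?_, ?_, ?_, ?_, ?_, ?_, ?_⟩
  · exact List.nodup_append.2 ⟨h.nodup, by simp, by
      intro a ha b hb; rw [List.mem_singleton.1 hb]; rintro rfl; exact hvQ ha⟩
  · intro w
    rw [List.mem_append, List.mem_singleton, h.mem_iff]
    by_cases hw : w = v
    · subst hw; simp; omega
    · simp [hw]
  · intro w
    by_cases hw : w = v
    · subst hw; simp; omega
    · simpa [hw] using h.side_le w
  · intro w hw
    rcases List.mem_append.1 hw with hw | hw
    · exact h.subset w hw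
    · rw [List.mem_singleton.1 hw]; exact hv
  · rw [hne _ (by rw [h.side_x₁]; decide), h.side_x₁]
  · rw [hne _ (by rw [h.side_x₂]; decide), h.side_x₂]
  · rw [hne _ (by rw [h.side_y₁]; decide), h.side_y₁]
  · rw [hne _ (by rw [h.side_y₂]; decide), h.side_y₂]
  · intro X Y hXY w
    by_cases hw : w = v
    · subst hw
      have := hf X Y hXY
      simp only [Function.update_self]
      exact ⟨fun e => this.1 (by omega), fun e => this.2 (by omega)⟩
    · simpa [hw] using h.forced X Y hXY w

/-- Comparing every member of a side with the single representative `x₁` or `y₁` is enough: an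
outside vertex sees each member exactly when it sees the representative. -/
theorem ClosureState.nonlinearPairOn (h : G.ClosureState S x₁ x₂ y₁ y₂ Q sd)
    (hP : G.Processed S x₁ y₁ Q sd) (adj₁ : G.Adj x₁ y₁) (adj₂ : G.Adj x₂ y₂)
    (not_adj₁ : ¬ G.Adj x₁ y₂) (not_adj₂ : ¬ G.Adj x₂ y₁) :
    G.NonlinearPairOn S {v | sd v = 1} {v | sd v = 2} x₁ x₂ y₁ y₂ := by
  have mem : ∀ {v s}, sd v = s → s ≠ 0 → v ∈ Q := fun hv hs => (h.mem_iff _).2 (hv ▸ hs)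
  have hom : ∀ s r, sd r = s → (s = 1 ∧ r = x₁ ∨ s = 2 ∧ r = y₁) → ∀ v ∈ S, ¬ sd v = 1 →
      ¬ sd v = 2 → ∀ a, sd a = s → (G.Adj v a ↔ G.Adj v r) := by
    intro s r hr hsr v hv h1 h2 a ha
    have h0 : sd v = 0 := by have := h.side_le v; omega
    have key := hP.closed a (mem ha (by omega)) r (by rw [ha]; exact hsr) v hv
    have har : a ≠ v := by rintro rfl; omega
    have hrv : r ≠ v := by rintro rfl; omega
    rw [G.adj_comm, G.adj_comm v r]
    constructor
    · intro hav
      by_contra hn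
      exact key (Or.inl ⟨hav, by simp [hrv, hn]⟩) h0
    · intro hrv'
      by_contra hn
      exact key (Or.inr ⟨hrv', by simp [har, hn]⟩) h0
  refine ⟨?_, ?_, ?_, ?_, ?_, ?_, ?_, h.side_x₁, h.side_x₂, h.side_y₁, h.side_y₂, adj₁, adj₂,
    not_adj₁, not_adj₂⟩
  · exact fun v hv => h.subset v (mem hv (by decide))
  · exact fun v hv => h.subset v (mem hv (by decide))
  · intro v hv hv'
    have h1 : sd v = 1 := hv
    have h2 : sd v = 2 := hv'
    omega
  · intro a ha b hb hne
    exact hP.clique a (mem ha (by decide)) b (mem hb (by decide)) hne (Eq.trans ha (Eq.symm hb))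
  · intro a ha b hb hne
    exact hP.clique a (mem ha (by decide)) b (mem hb (by decide)) hne (Eq.trans ha (Eq.symm hb))
  · intro v hv h1 h2 a ha b hb hab
    have := hom 1 x₁ h.side_x₁ (Or.inl ⟨rfl, rfl⟩) v hv h1 h2
    exact (this b hb).2 ((this a ha).1 hab)
  · intro v hv h1 h2 a ha b hb hab
    have := hom 2 y₁ h.side_y₁ (Or.inr ⟨rfl, rfl⟩) v hv h1 h2
    exact (this b hb).2 ((this a ha).1 hab)

theorem length_le_of_clique [Fintype V] [DecidableEq V] [DecidableRel G.Adj] {D : ℕ}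
    (hD : ∀ v, G.degree v ≤ D) {L : List V} (hL : L.Nodup)
    (hc : ∀ u ∈ L, ∀ w ∈ L, u ≠ w → G.Adj u w) : L.length ≤ D + 1 := by
  cases L with
  | nil => simp
  | cons u L =>
    rw [← List.toFinset_card_of_nodup hL]
    have : (u :: L).toFinset ⊆ insert u (G.neighborFinset u) := by
      intro w hw
      rw [List.mem_toFinset] at hw
      by_cases e : w = u
      · simp [e]
      · exact Finset.mem_insert_of_mem ((G.mem_neighborFinset _ _).2
          (hc u (by simp) w hw (Ne.symm e)))
    refine (Finset.card_le_card this).trans ((Finset.card_insert_le _ _).trans ?_)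
    rw [card_neighborFinset_eq_degree]
    exact Nat.add_le_add_right (hD u) 1

/-- The processed vertices split into two cliques, each of size at most `D + 1`. The unprocessed
part of the queue needs no such bound. -/
theorem Processed.length_le [Fintype V] [DecidableEq V] [DecidableRel G.Adj] {D : ℕ}
    (hD : ∀ v, G.degree v ≤ D) (h : G.ClosureState S x₁ x₂ y₁ y₂ Q sd)
    (hP : G.Processed S x₁ y₁ P sd) (hPQ : List.Sublist P Q) : P.length ≤ 2 * D + 2 := by
  have hn := hPQ.nodup h.nodup
  have cl : ∀ s, (P.filter (fun v => sd v = s)).length ≤ D + 1 := fun s =>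
    length_le_of_clique hD (hn.filter _) (by
      intro u hu w hw hne
      simp only [List.mem_filter, decide_eq_true_eq] at hu hw
      exact hP.clique u hu.1 w hw.1 hne (hu.2.trans hw.2.symm))
  have h1 := List.length_eq_length_filter_add (l := P) (fun v => decide (sd v = 1))
  have h2 : P.filter (fun v => !decide (sd v = 1)) = P.filter (fun v => sd v = 2) := by
    refine List.filter_congr fun v hv => ?_
    have := (h.mem_iff v).1 (hPQ.subset hv)
    have := h.side_le v
    by_cases e : sd v = 1
    · simp [e]
    · have : sd v = 2 := by omega
      simp [this]
  rw [h2] at h1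
  have := cl 1
  have := cl 2
  omega

end SimpleGraph

namespace RAM

/-! ### The program

Array `3` marks the vertices that are left, array `4` is the matrix of the closed neighbourhoods,
arrays `5` and `6` hold the degrees and the lists of neighbours, array `7` the sides of the
vertices in the closure computations, array `8` the queue, and the arrays from `9` on are scalar
variables. -/

/-- The number of vertices. -/
abbrev numV : Expr := .get 0 (.lit 0)

/-- The entry `(i, v)` of array `a`, seen as a matrix with `n` columns. -/
abbrev entry (a : ℕ) (i v : Expr) : Expr := .get a (.add (.mul i numV) v)

/-- Run `p` with variable `23` set to each neighbour of variable `x`. -/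
def forNbr (x : ℕ) (p : Program) : Program :=
  forLoop 10 (.get 5 (var x)) (.seq (setVar 23 (entry 6 (var 10) (var x))) p)

/-- Look for a vertex `w` that is left and sees `x` but not `y`; the flag `f` tells whether there
is one. -/
def find (x y w f : ℕ) : Program :=
  .seq (setVar f (.lit 0)) (forNbr x
    (.ite (.get 3 (var 23))
      (.ite (entry 4 (var y) (var 23)) .skip
        (.seq (setVar w (var 23)) (setVar f (.lit 1)))) .skip))

/-- Put vertex `23` into the queue, on the side other than `21`. -/
def push : Program :=
  .seq (.assign 7 (.add (.mul (var 9) numV) (var 23)) (.sub (.lit 3) (var 21)))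
    (.seq (.assign 8 (var 18) (var 23)) (setVar 18 (.add (var 18) (.lit 1))))

/-- Push the vertices that are left and see `x` but not `y`. -/
def scan (x y : ℕ) : Program :=
  forNbr x
    (.ite (.get 3 (var 23))
      (.ite (entry 4 (var y) (var 23)) .skip
        (.ite (entry 7 (var 9) (var 23)) .skip push)) .skip)

/-- Check that vertex `20` is adjacent to the vertices on its side that have been processed. -/
def checkClique : Program :=
  forLoop 10 (var 17) (.seq (setVar 23 (.get 8 (var 10)))
    (.ite (.add (.sub (entry 7 (var 9) (var 23)) (var 21))
        (.sub (var 21) (entry 7 (var 9) (var 23)))) .skip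
      (.ite (entry 4 (var 20) (var 23)) .skip (setVar 19 (.lit 0)))))

/-- Process the next vertex of the queue. -/
def closureStep : Program :=
  .seq (setVar 20 (.get 8 (var 17)))
  (.seq (setVar 21 (entry 7 (var 9) (var 20)))
  (.seq (.ite (.sub (var 21) (.lit 1)) (setVar 22 (var 13)) (setVar 22 (var 11)))
  (.seq checkClique
  (.seq (.ite (var 19) (.seq (scan 20 22) (scan 22 20)) .skip)
    (setVar 17 (.add (var 17) (.lit 1)))))))

/-- Process the queue. -/
def closureLoop : Program :=
  .loop (.mul (.sub (var 18) (var 17)) (var 19)) closureStep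

/-- Push vertex `a`. -/
def pushVar (a : ℕ) : Program := .seq (setVar 23 (var a)) push

/-- Fill the queue with the four-cycle. -/
def startQueue : Program :=
  .seq (setVar 17 (.lit 0)) (.seq (setVar 18 (.lit 0)) (.seq (setVar 19 (.lit 1))
  (.seq (setVar 21 (.lit 2)) (.seq (pushVar 11) (.seq (pushVar 12)
  (.seq (setVar 21 (.lit 1)) (.seq (pushVar 13) (pushVar 14))))))))

/-- Delete the vertices of the queue, apart from `x₁`, `y₁`, `y₂`. -/
def reduce : Program :=
  .seq (forLoop 10 (var 18) (.assign 3 (.get 8 (var 10)) (.lit 0)))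
  (.seq (.assign 3 (var 11) (.lit 1)) (.seq (.assign 3 (var 13) (.lit 1))
    (.assign 3 (var 14) (.lit 1))))

/-- Process the edge with index `9`. -/
def processEdge : Program :=
  .seq (setVar 11 (.get 1 (var 9))) (.seq (setVar 12 (.get 2 (var 9)))
  (.ite (.mul (.get 3 (var 11)) (.get 3 (var 12)))
    (.seq (find 11 12 13 15) (.seq (find 12 11 14 16)
      (.ite (.mul (var 15) (var 16))
        (.seq startQueue (.seq closureLoop (.ite (var 19) reduce .skip))) .skip)))
    .skip))

/-- Mark all vertices, and the diagonal of the matrix. -/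
def markAll : Program :=
  forLoop 10 numV (.seq (.assign 3 (var 10) (.lit 1))
    (.assign 4 (.add (.mul (var 10) numV) (var 10)) (.lit 1)))

/-- Record that `y` is a neighbour of `x`. -/
def addNbr (x y : ℕ) : Program :=
  .seq (.assign 4 (.add (.mul (var x) numV) (var y)) (.lit 1))
  (.seq (.assign 6 (.add (.mul (.get 5 (var x)) numV) (var x)) (var y))
    (.assign 5 (var x) (.add (.get 5 (var x)) (.lit 1))))

/-- Read the edge list. -/
def buildGraph : Program :=
  forLoop 9 (.get 0 (.lit 1)) (.seq (setVar 11 (.get 1 (var 9))) (.seq (setVar 12 (.get 2 (var 9)))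
    (.seq (addNbr 11 12) (addNbr 12 11))))

/-- The whole program. -/
def mainProgram : Program :=
  .seq markAll (.seq buildGraph (forLoop 9 (.get 0 (.lit 1)) processEdge))

/-- The rank `8` comes from the test for equal sides in `checkClique`: it adds the two truncated
differences, which both vanish only for equal numbers, and each contains a matrix entry of rank `3`.
-/
theorem tame_mainProgram : mainProgram.tame 8 = true := by decide

/-! ### Specifications -/

variable {n : ℕ} {G : SimpleGraph (Fin n)} {es : List (Fin n × Fin n)} {D : ℕ}

/-- Row and column are the quotient and the remainder on division by `n`, so distinct cells of a
flattened matrix do not collide. -/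
theorem entry_inj {a b : ℕ} {u v : Fin n} : a * n + u = b * n + v ↔ a = b ∧ u = v := by
  constructor
  · intro h
    have hn : 0 < n := u.pos
    have h1 : (a * n + u) / n = a := by
      rw [mul_comm, Nat.mul_add_div hn, Nat.div_eq_of_lt u.isLt, add_zero]
    have h2 : (b * n + v) / n = b := by
      rw [mul_comm, Nat.mul_add_div hn, Nat.div_eq_of_lt v.isLt, add_zero]
    have hab : a = b := by rw [← h1, h, h2]
    subst hab
    exact ⟨rfl, Fin.ext (by omega)⟩
  · rintro ⟨rfl, rfl⟩; rfl

/-- The memory holds the graph `G` with edge list `es` and degrees at most `D`. -/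
structure Holds (G : SimpleGraph (Fin n)) (es : List (Fin n × Fin n)) (D : ℕ) (σ : Mem) : Prop where
  num : σ 0 0 = n
  numEdges : σ 0 1 = es.length
  ends : ∀ t (h : t < es.length), σ 1 t = (es[t].1 : ℕ) ∧ σ 2 t = (es[t].2 : ℕ)
  adj : ∀ u v : Fin n, σ 4 (u * n + v) ≠ 0 ↔ u = v ∨ G.Adj u v
  nbr_adj : ∀ (u : Fin n) (i : ℕ), i < σ 5 u → ∃ v : Fin n, σ 6 (i * n + u) = v ∧ G.Adj u v
  nbr_surj : ∀ u v : Fin n, G.Adj u v → ∃ i < σ 5 u, σ 6 (i * n + u) = v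
  deg_le : ∀ u : Fin n, σ 5 u ≤ D

theorem Holds.congr {σ τ : Mem} (h : Holds G es D σ)
    (hτ : ∀ a ∈ [0, 1, 2, 4, 5, 6], τ a = σ a) : Holds G es D τ := by
  have h0 := hτ 0 (by decide)
  have h1 := hτ 1 (by decide)
  have h2 := hτ 2 (by decide)
  have h4 := hτ 4 (by decide)
  have h5 := hτ 5 (by decide)
  have h6 := hτ 6 (by decide)
  constructor
  · rw [h0]; exact h.num
  · rw [h0]; exact h.numEdges
  · rw [h1, h2]; exact h.ends
  · rw [h4]; exact h.adj
  · rw [h5, h6]; exact h.nbr_adj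
  · rw [h5, h6]; exact h.nbr_surj
  · rw [h5]; exact h.deg_le

/-- `I` is the loop invariant, and `J v` records that the neighbour `v` has been handled. Later
iterations must preserve `J`; as the stored list is exhaustive, `J` then holds for all neighbours at
the end. -/
theorem wp_forNbr {x : ℕ} {p : Program} {σ : Mem} {Q : Mem → ℕ → Prop} (u : Fin n) (T : ℕ)
    (I : Mem → Prop) (J : Fin n → Mem → Prop) (hσ : Holds G es D σ) (hx : σ x 0 = u)
    (hp : ∀ a ∈ [0, 5, 6, 10, x], a ∉ p.writes) (hx10 : x ≠ 10 ∧ x ≠ 23)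
    (hI : ∀ τ τ' : Mem, (∀ a, a ≠ 10 → a ≠ 23 → τ' a = τ a) →
      (I τ → I τ') ∧ ∀ v, J v τ → J v τ')
    (h0 : I σ)
    (hs : ∀ (v : Fin n) (τ : Mem), (∀ a, a ∉ 10 :: 23 :: p.writes → τ a = σ a) → G.Adj u v →
      τ 23 0 = v → I τ → WP p τ fun υ s => s ≤ T ∧ I υ ∧ J v υ ∧ ∀ w, J w τ → J w υ)
    (hQ : ∀ τ t, (∀ a, a ∉ 10 :: 23 :: p.writes → τ a = σ a) → I τ → (∀ v, G.Adj u v → J v τ) →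
      t ≤ D * (T + 30) + 30 → Q τ t) : WP (forNbr x p) σ Q := by
  have hw : ∀ a, a ∉ 10 :: 23 :: p.writes →
      a ∉ 10 :: (Program.seq (setVar 23 (entry 6 (var 10) (var x))) p).writes := by
    intro a ha
    simpa [Program.writes] using ha
  have hw' : ∀ a, a ∉ 10 :: (Program.seq (setVar 23 (entry 6 (var 10) (var x))) p).writes →
      a ∉ 10 :: 23 :: p.writes := by
    intro a ha
    simpa [Program.writes] using ha
  have hpw : ∀ a ∈ [0, 5, 6, x], a ∉ 10 :: 23 :: p.writes := by
    intro a ha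
    have h1 : a ∉ p.writes := hp a (by simp at ha ⊢; tauto)
    simp only [List.mem_cons, List.not_mem_nil, or_false] at ha ⊢
    rcases ha with rfl | rfl | rfl | rfl <;> simp [h1, hx10]
  have hp0 := hpw 0 (by simp)
  have hp5 := hpw 5 (by simp)
  have hp6 := hpw 6 (by simp)
  have hpx := hpw x (by simp)
  refine wp_forLoop (σ 5 u) (T + 12) (fun k τ => I τ ∧ ∀ j < k, ∀ v : Fin n,
    σ 6 (j * n + u) = v → J v τ) ?_ ?_ ?_ ?_ ?_ ?_
  · simpa [Program.writes] using hp 10 (by simp)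
  · intro τ hτ
    simp only [Expr.eval]
    rw [hτ 5 (hw _ hp5), hτ x (hw _ hpx), hx]
  · intro k τ y h
    have h1 := hI τ (τ.store 10 0 y) (fun a ha _ => Mem.store_of_ne ha _ _)
    exact ⟨h1.1 h.1, fun j hj v hv => h1.2 v (h.2 j hj v hv)⟩
  · exact ⟨h0, by simp⟩
  · intro k hk τ hτ hk' h
    rw [wp_seq, wp_assign]
    simp only [Expr.eval, Expr.cost]
    rw [hτ 6 (hw _ hp6), hτ 0 (hw _ hp0), hτ x (hw _ hpx), hx, hσ.num, hk']
    obtain ⟨v, hv, huv⟩ := hσ.nbr_adj u k hk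
    rw [hv]
    have h1 := hI τ (τ.store 23 0 v) (fun a _ ha => Mem.store_of_ne ha _ _)
    refine (hs v (τ.store 23 0 v) ?_ huv ?_ (h1.1 h.1)).mono ?_
    · intro a ha
      have h23 : a ≠ 23 := by rintro rfl; simp at ha
      rw [Mem.store_of_ne h23]
      exact hτ a (hw _ ha)
    · rw [Mem.store_self_apply, if_pos rfl]
    · rintro υ s - ⟨hsT, hυ, hJ, hJ'⟩
      refine ⟨by omega, hυ, ?_⟩
      intro j hj w hw
      by_cases hjk : j = k
      · subst hjk
        have : w = v := Fin.ext (hw.symm.trans hv)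
        rw [this]; exact hJ
      · exact hJ' w (h1.2 w (h.2 j (by omega) w hw))
  · intro τ t hτ h ht
    refine hQ τ t (fun a ha => hτ a (hw a ha)) h.1 ?_ ?_
    · intro v hv
      obtain ⟨i, hi, hiv⟩ := hσ.nbr_surj u v hv
      exact h.2 i hi v hiv
    · simp only [Expr.cost] at ht
      have := Nat.mul_le_mul_right (T + 12 + (1 + 1 + 1) + 10) (hσ.deg_le u)
      have : D * (T + 12 + (1 + 1 + 1) + 10) ≤ D * (T + 30) := Nat.mul_le_mul_left _ (by omega)
      omega

theorem wp_find {x y w f : ℕ} {σ : Mem} (hxyz : 11 ≤ x ∧ x ≤ 12 ∧ 11 ≤ y ∧ y ≤ 12 ∧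
    13 ≤ w ∧ w ≤ 16 ∧ 13 ≤ f ∧ f ≤ 16 ∧ w ≠ f) (hσ : Holds G es D σ) (u v : Fin n)
    (hx : σ x 0 = u) (hy : σ y 0 = v) :
    WP (find x y w f) σ fun τ t => t ≤ 80 * (D + 1) ∧
      (τ f 0 ≠ 0 → ∃ z : Fin n, τ w 0 = z ∧ z ∈ output n σ ∧ G.SeesOnly u v z) ∧
      (τ f 0 = 0 → ∀ z ∈ output n σ, ¬ G.SeesOnly u v z) := by
  obtain ⟨hx1, hx2, hy1, hy2, hw1, hw2, hf1, hf2, hwf⟩ := hxyz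
  have hfr : ∀ a, a ∉ 10 :: 23 :: (Program.ite (.get 3 (var 23))
      (.ite (entry 4 (var y) (var 23)) .skip
        (.seq (setVar w (var 23)) (setVar f (.lit 1)))) .skip).writes ↔
        a ≠ 10 ∧ a ≠ 23 ∧ a ≠ w ∧ a ≠ f := by
    intro a; simp [Program.writes]
  rw [find, wp_seq, wp_assign]
  simp only [Expr.eval, Expr.cost]
  -- The invariant is that a raised flag has a valid witness; the record for `z` is that a flag
  -- still at zero rules `z` out. The flag is never lowered again, so both persist.
  refine wp_forNbr (G := G) (es := es) (D := D) u 30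
    (fun τ => τ f 0 ≠ 0 → ∃ z : Fin n, τ w 0 = z ∧ z ∈ output n σ ∧ G.SeesOnly u v z)
    (fun z τ => τ f 0 = 0 → z ∈ output n σ → ¬ G.SeesOnly u v z) ?_ ?_ ?_ ?_ ?_ ?_ ?_ ?_
  · refine hσ.congr fun a ha => Mem.store_of_ne ?_ _ _
    simp only [List.mem_cons, List.not_mem_nil, or_false] at ha
    omega
  · rw [Mem.store_of_ne (by omega), hx]
  · intro a ha
    simp only [List.mem_cons, List.not_mem_nil, or_false, Program.writes] at ha ⊢
    simp only [List.nil_append, List.append_nil, List.mem_append, List.mem_cons, List.not_mem_nil,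
      or_false]
    omega
  · omega
  · intro τ τ' h
    rw [h f (by omega) (by omega), h w (by omega) (by omega)]
    exact ⟨id, fun _ => id⟩
  · intro h
    rw [Mem.store_self_apply, if_pos rfl] at h
    exact absurd rfl h
  · intro z τ hτ huz hz hI
    have hτ' : ∀ a, a ≠ 10 ∧ a ≠ 23 ∧ a ≠ w ∧ a ≠ f → τ a = σ a := by
      intro a ha
      rw [hτ a ((hfr a).2 ha), Mem.store_of_ne ha.2.2.2]
    have e3 : τ 3 = σ 3 := hτ' 3 (by omega)
    have e4 : τ 4 = σ 4 := hτ' 4 (by omega)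
    have e0 : τ 0 = σ 0 := hτ' 0 (by omega)
    have ey : τ y = σ y := hτ' y (by omega)
    simp only [wp_ite, wp_seq, wp_assign, wp_skip, Expr.eval, Expr.cost]
    rw [e3, e4, e0, ey, hz, hσ.num, hy]
    refine ⟨fun h3 => ⟨fun h4 => ?_, fun h4 => ?_⟩, fun h3 => ?_⟩
    · refine ⟨by omega, hI, ?_, fun _ h => h⟩
      intro _ _ hs
      exact hs.2 ((hσ.adj v z).1 h4)
    · refine ⟨by omega, ?_, ?_, ?_⟩
      · intro _
        refine ⟨z, ?_, h3, huz, fun e => (hσ.adj v z).2 e h4⟩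
        rw [Mem.store_of_ne hwf, Mem.store_self_apply, if_pos rfl]
      · intro h
        rw [Mem.store_self_apply, if_pos rfl] at h
        exact absurd h one_ne_zero
      · intro z' _ h
        rw [Mem.store_self_apply, if_pos rfl] at h
        exact absurd h one_ne_zero
    · exact ⟨by omega, hI, fun _ h => absurd h3 h, fun _ h => h⟩
  · intro τ t hτ hI hJ ht
    refine ⟨by omega, hI, ?_⟩
    intro h z hz hs
    exact hJ z hs.1 h hz hs

end RAM

/-! ### Queue operations and the clique test -/

namespace RAM
variable {n : ℕ} {G : SimpleGraph (Fin n)} {es : List (Fin n × Fin n)} {D : ℕ}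

/-- The memory holds the queue `Q` and, in row `t` of array `7`, the sides `sd`; the later rows are
still empty. -/
structure QueueState (t : ℕ) (σ : Mem) (Q : List (Fin n)) (sd : Fin n → ℕ) : Prop where
  tail : σ 18 0 = Q.length
  queue : ∀ i (h : i < Q.length), σ 8 i = (Q[i] : ℕ)
  side : ∀ v : Fin n, σ 7 (t * n + v) = sd v
  clean : ∀ t' > t, ∀ v : Fin n, σ 7 (t' * n + v) = 0

theorem QueueState.congr {t : ℕ} {σ τ : Mem} {Q : List (Fin n)} {sd : Fin n → ℕ}
    (h : QueueState t σ Q sd) (h7 : τ 7 = σ 7) (h8 : τ 8 = σ 8) (h18 : τ 18 = σ 18) :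
    QueueState t τ Q sd := by
  constructor
  · rw [h18]; exact h.tail
  · rw [h8]; exact h.queue
  · rw [h7]; exact h.side
  · rw [h7]; exact h.clean

theorem wp_push {t s : ℕ} {σ : Mem} {Q : List (Fin n)} {sd : Fin n → ℕ} {v : Fin n}
    (h : QueueState t σ Q sd) (hn : σ 0 0 = n) (ht : σ 9 0 = t) (hv : σ 23 0 = v)
    (hs : σ 21 0 = s) :
    WP push σ fun τ k => k ≤ 30 ∧ QueueState t τ (Q ++ [v]) (Function.update sd v (3 - s)) := by
  simp only [push, wp_seq, wp_assign, Expr.eval, Expr.cost]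
  rw [hn, ht, hv, hs]
  simp only [Mem.store_of_ne (show (18 : ℕ) ≠ 7 by decide),
    Mem.store_of_ne (show (18 : ℕ) ≠ 8 by decide), Mem.store_of_ne (show (23 : ℕ) ≠ 7 by decide)]
  rw [hv, h.tail]
  refine ⟨by omega, ?_, ?_, ?_, ?_⟩
  · simp [Mem.store_self_apply]
  · intro i hi
    rw [Mem.store_of_ne (by decide), Mem.store_self_apply]
    rw [List.length_append, List.length_singleton] at hi
    by_cases e : i = Q.length
    · subst e; simp
    · rw [if_neg e, Mem.store_of_ne (by decide), h.queue i (by omega),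
        List.getElem_append_left (by omega)]
  · intro w
    rw [Mem.store_of_ne (by decide), Mem.store_of_ne (by decide), Mem.store_self_apply]
    by_cases e : w = v
    · subst e; simp
    · rw [if_neg (fun e' => e (entry_inj.1 e').2), Function.update_of_ne e]
      exact h.side w
  · intro t' ht' w
    rw [Mem.store_of_ne (by decide), Mem.store_of_ne (by decide), Mem.store_self_apply,
      if_neg (fun e => (ne_of_gt ht') (entry_inj.1 e).1)]
    exact h.clean t' ht' w

/-- The predicate `P` is any property of queue and sides that survives a legitimate push, so the
same specification serves both scanning directions. A nonzero cell in row `t` serves as the record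
that a vertex has been handled. -/
theorem wp_scan {x y t s : ℕ} {σ : Mem} (hxy : x = 20 ∧ y = 22 ∨ x = 22 ∧ y = 20)
    (hσ : Holds G es D σ) {p q : Fin n} (hx : σ x 0 = p) (hy : σ y 0 = q) (ht : σ 9 0 = t)
    (hs : σ 21 0 = s) (hs' : s = 1 ∨ s = 2) (P : List (Fin n) → (Fin n → ℕ) → Prop)
    (hP : ∀ Q sd v, P Q sd → v ∈ output n σ → G.SeesOnly p q v → sd v = 0 →
      P (Q ++ [v]) (Function.update sd v (3 - s)))
    {Q : List (Fin n)} {sd : Fin n → ℕ} (hQ : QueueState t σ Q sd) (h0 : P Q sd) :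
    WP (scan x y) σ fun τ k => k ≤ 120 * (D + 1) ∧ ∃ Q' sd', QueueState t τ Q' sd' ∧ P Q' sd' ∧
      ∀ v ∈ output n σ, G.SeesOnly p q v → sd' v ≠ 0 := by
  have hyw : ∀ a, a ≠ 7 → a ≠ 8 → a ≠ 10 → a ≠ 18 → a ≠ 23 → a ∉ 10 :: 23 :: (Program.ite
      (.get 3 (var 23)) (.ite (entry 4 (var y) (var 23)) .skip
        (.ite (entry 7 (var 9) (var 23)) .skip push)) .skip).writes := by
    intro a h1 h2 h3 h4 h5
    simp [Program.writes, push, *]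
  refine wp_forNbr (G := G) (es := es) (D := D) p 80
    (fun τ => ∃ Q sd, QueueState t τ Q sd ∧ P Q sd)
    (fun v τ => v ∈ output n σ → G.SeesOnly p q v → τ 7 (t * n + v) ≠ 0) hσ hx ?_ (by omega) ?_
    ⟨Q, sd, hQ, h0⟩ ?_ ?_
  · intro a ha
    have : a = 0 ∨ a = 5 ∨ a = 6 ∨ a = 10 ∨ a = 20 ∨ a = 22 := by
      simp only [List.mem_cons, List.not_mem_nil, or_false] at ha; omega
    rcases this with rfl | rfl | rfl | rfl | rfl | rfl <;> simp [Program.writes, push]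
  · intro τ τ' h
    rw [h 7 (by decide) (by decide)]
    refine ⟨?_, fun _ => id⟩
    rintro ⟨Q, sd, h1, h2⟩
    exact ⟨Q, sd, h1.congr (h 7 (by decide) (by decide)) (h 8 (by decide) (by decide))
      (h 18 (by decide) (by decide)), h2⟩
  · rintro v τ hτ hpv hv ⟨Q, sd, hQ, hPQ⟩
    have e3 : τ 3 = σ 3 := hτ 3 (hyw 3 (by decide) (by decide) (by decide) (by decide) (by decide))
    have e4 : τ 4 = σ 4 := hτ 4 (hyw 4 (by decide) (by decide) (by decide) (by decide) (by decide))
    have e0 : τ 0 = σ 0 := hτ 0 (hyw 0 (by decide) (by decide) (by decide) (by decide) (by decide))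
    have e9 : τ 9 = σ 9 := hτ 9 (hyw 9 (by decide) (by decide) (by decide) (by decide) (by decide))
    have e21 : τ 21 = σ 21 :=
      hτ 21 (hyw 21 (by decide) (by decide) (by decide) (by decide) (by decide))
    have ey : τ y = σ y :=
      hτ y (hyw y (by omega) (by omega) (by omega) (by omega) (by omega))
    simp only [wp_ite, wp_skip, Expr.eval, Expr.cost]
    rw [e3, e4, e0, e9, ey, hv, hσ.num, hy, ht, hQ.side]
    refine ⟨fun h3 => ⟨fun h4 => ?_, fun h4 => ⟨fun h7 => ?_, fun h7 => ?_⟩⟩, fun h3 => ?_⟩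
    · refine ⟨by omega, ⟨Q, sd, hQ, hPQ⟩, ?_, fun _ h => h⟩
      intro _ hs
      exact absurd ((hσ.adj q v).1 h4) hs.2
    · refine ⟨by omega, ⟨Q, sd, hQ, hPQ⟩, ?_, fun _ h => h⟩
      exact fun _ _ => h7
    · refine (wp_push hQ (by rw [e0, hσ.num]) (by rw [e9, ht]) hv (by rw [e21, hs])).mono ?_
      rintro υ k hfr ⟨hk, hυ⟩
      refine ⟨by omega, ⟨_, _, hυ, hP Q sd v hPQ h3 ⟨hpv, fun e => (hσ.adj q v).2 e h4⟩ h7⟩, ?_, ?_⟩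
      · intro _ _
        rw [hυ.side, Function.update_self]
        omega
      · intro w hw h1 h2
        have := hw h1 h2
        rw [hQ.side] at this
        rw [hυ.side, Function.update_of_ne (by rintro rfl; exact this h7)]
        exact this
    · exact ⟨by omega, ⟨Q, sd, hQ, hPQ⟩, fun h => absurd h3 h, fun _ h => h⟩
  · rintro τ k hτ ⟨Q', sd', hQ', hP'⟩ hJ hk
    refine ⟨by omega, Q', sd', hQ', hP', ?_⟩
    intro v hv hsv
    have := hJ v hsv.1 hv hsv
    rwa [hQ'.side] at this

theorem wp_checkClique {t s h : ℕ} {σ : Mem} (hσ : Holds G es D σ) {u : Fin n}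
    (ht : σ 9 0 = t) (hu : σ 20 0 = u) (hs : σ 21 0 = s) (hh : σ 17 0 = h) (hok : σ 19 0 ≠ 0)
    {Q : List (Fin n)} {sd : Fin n → ℕ} (hQ : QueueState t σ Q sd) (hhQ : h ≤ Q.length) :
    WP checkClique σ fun τ k => k ≤ 80 * (h + 1) ∧
      (τ 19 0 ≠ 0 → ∀ w ∈ Q.take h, sd w = s → u = w ∨ G.Adj u w) ∧
      (τ 19 0 = 0 → ∃ w ∈ Q.take h, sd w = s ∧ ¬ (u = w ∨ G.Adj u w)) := by
  refine wp_forLoop h 60 (fun k τ =>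
    (τ 19 0 ≠ 0 → ∀ w ∈ Q.take k, sd w = s → u = w ∨ G.Adj u w) ∧
    (τ 19 0 = 0 → ∃ w ∈ Q.take k, sd w = s ∧ ¬ (u = w ∨ G.Adj u w))) ?_ ?_ ?_ ?_ ?_ ?_
  · decide
  · intro τ hτ
    simp only [Expr.eval]
    rw [hτ 17 (by decide), hh]
  · exact fun _ _ _ h => h
  · exact ⟨fun _ => by simp, fun h => absurd h hok⟩
  · rintro k hk τ hτ hk' ⟨I1, I2⟩
    have hkQ : k < Q.length := by omega
    have e0 : τ 0 = σ 0 := hτ 0 (by decide)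
    have e4 : τ 4 = σ 4 := hτ 4 (by decide)
    have e7 : τ 7 = σ 7 := hτ 7 (by decide)
    have e8 : τ 8 = σ 8 := hτ 8 (by decide)
    have e9 : τ 9 = σ 9 := hτ 9 (by decide)
    have e20 : τ 20 = σ 20 := hτ 20 (by decide)
    have e21 : τ 21 = σ 21 := hτ 21 (by decide)
    have tk : Q.take (k + 1) = Q.take k ++ [Q[k]] := by simp
    rw [tk]
    simp only [wp_ite, wp_skip, wp_seq, wp_assign, Expr.eval, Expr.cost, Mem.store_self_apply,
      if_true, Mem.store_of_ne (show (7 : ℕ) ≠ 23 by decide),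
      Mem.store_of_ne (show (9 : ℕ) ≠ 23 by decide), Mem.store_of_ne (show (0 : ℕ) ≠ 23 by decide),
      Mem.store_of_ne (show (4 : ℕ) ≠ 23 by decide), Mem.store_of_ne (show (20 : ℕ) ≠ 23 by decide),
      Mem.store_of_ne (show (21 : ℕ) ≠ 23 by decide), Mem.store_of_ne (show (19 : ℕ) ≠ 23 by decide)]
    rw [e0, e4, e7, e8, e9, e20, e21, hk', hσ.num, ht, hu, hs, hQ.queue k hkQ, hQ.side]
    refine ⟨fun h1 => ?_, fun h1 => ⟨fun h2 => ?_, fun h2 => ?_⟩⟩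
    · refine ⟨by omega, ?_, ?_⟩
      · intro h3 w hw hws
        rcases List.mem_append.1 hw with hw | hw
        · exact I1 h3 w hw hws
        · rw [List.mem_singleton.1 hw] at hws; omega
      · intro h3
        obtain ⟨w, hw, h4⟩ := I2 h3
        exact ⟨w, List.mem_append_left _ hw, h4⟩
    · refine ⟨by omega, ?_, ?_⟩
      · intro h3 w hw hws
        rcases List.mem_append.1 hw with hw | hw
        · exact I1 h3 w hw hws
        · rw [List.mem_singleton.1 hw]; exact (hσ.adj _ _).1 h2
      · intro h3
        obtain ⟨w, hw, h4⟩ := I2 h3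
        exact ⟨w, List.mem_append_left _ hw, h4⟩
    · refine ⟨by omega, fun h3 => absurd rfl h3, fun _ => ?_⟩
      exact ⟨Q[k], List.mem_append_right _ (List.mem_singleton_self _), by omega, fun e => (hσ.adj _ _).2 e h2⟩
  · rintro τ k hτ hI hk
    simp only [Expr.cost] at hk
    exact ⟨by omega, hI⟩

end RAM

/-! ### The closure computation -/

namespace RAM
variable {n : ℕ} {G : SimpleGraph (Fin n)} {es : List (Fin n × Fin n)} {D : ℕ}

/-- The invariant of the closure computation. -/
def ClosureInv (G : SimpleGraph (Fin n)) (t : ℕ) (S : Set (Fin n)) (x₁ x₂ y₁ y₂ : Fin n)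
    (τ : Mem) : Prop :=
  ∃ Q sd, QueueState t τ Q sd ∧ G.ClosureState S x₁ x₂ y₁ y₂ Q sd ∧ τ 17 0 ≤ Q.length ∧
    (τ 19 0 ≠ 0 → G.Processed S x₁ y₁ (Q.take (τ 17 0)) sd) ∧
    (τ 19 0 = 0 → ∀ X Y, ¬ G.NonlinearPairOn S X Y x₁ x₂ y₁ y₂)

theorem wp_scan_scan {t : ℕ} {σ : Mem} {x₁ x₂ y₁ y₂ u r : Fin n}
    (hσ : Holds G es D σ) (ht : σ 9 0 = t) (hu : σ 20 0 = u) (hr : σ 22 0 = r)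
    {Q : List (Fin n)} {sd : Fin n → ℕ} (hs : σ 21 0 = sd u) (hs' : sd u = 1 ∨ sd u = 2)
    (hur : sd r = sd u) (hQ : QueueState t σ Q sd)
    (hC : G.ClosureState (output n σ) x₁ x₂ y₁ y₂ Q sd) :
    WP (.seq (scan 20 22) (scan 22 20)) σ fun τ k => k ≤ 240 * (D + 1) ∧ ∃ Q' sd',
      QueueState t τ Q' sd' ∧ G.ClosureState (output n σ) x₁ x₂ y₁ y₂ Q' sd' ∧ Q <+: Q' ∧
      (∀ w, sd w ≠ 0 → sd' w = sd w) ∧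
      ∀ v ∈ output n σ, G.SeesOnly u r v ∨ G.SeesOnly r u v → sd' v ≠ 0 := by
  -- The predicate `P` carries the achievement of the first scan through the second; the first scan
  -- uses the empty predicate. Existing sides are never changed, so `p` and `q` keep forcing
  -- vertices to the opposite side.
  have step : ∀ (P : Fin n → Prop) (p q : Fin n), sd p = sd u → sd q = sd u → ∀ Q' sd' v,
      (G.ClosureState (output n σ) x₁ x₂ y₁ y₂ Q' sd' ∧ Q <+: Q' ∧ (∀ w, sd w ≠ 0 → sd' w = sd w) ∧
        ∀ w, P w → sd' w ≠ 0) → v ∈ output n σ → G.SeesOnly p q v → sd' v = 0 →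
      (G.ClosureState (output n σ) x₁ x₂ y₁ y₂ (Q' ++ [v]) (Function.update sd' v (3 - sd u)) ∧
        Q <+: Q' ++ [v] ∧ (∀ w, sd w ≠ 0 → Function.update sd' v (3 - sd u) w = sd w) ∧
        ∀ w, P w → Function.update sd' v (3 - sd u) w ≠ 0) := by
    rintro P p q hp hq Q' sd' v ⟨h1, h2, h3, h4⟩ hv hsv h0
    have hp' : sd' p = sd u := by rw [h3 p (by omega), hp]
    have hq' : sd' q = sd u := by rw [h3 q (by omega), hq]
    refine ⟨h1.push hv h0 hs' (h1.forced_of_seesOnly hp' hq' hv hsv),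
      h2.trans (List.prefix_append _ _), ?_, ?_⟩
    · intro w hw
      rw [Function.update_of_ne, h3 w hw]
      rintro rfl
      exact hw (by rw [← h3 w hw]; exact h0)
    · intro w hw
      rw [Function.update_of_ne]
      · exact h4 w hw
      · rintro rfl; exact h4 w hw h0
  rw [wp_seq]
  refine (wp_scan (Or.inl ⟨rfl, rfl⟩) hσ hu hr ht hs hs'
    (fun Q' sd' => G.ClosureState (output n σ) x₁ x₂ y₁ y₂ Q' sd' ∧ Q <+: Q' ∧
      (∀ w, sd w ≠ 0 → sd' w = sd w) ∧ ∀ w : Fin n, False → sd' w ≠ 0)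
    (step _ u r rfl hur) hQ ⟨hC, List.prefix_rfl, fun _ _ => rfl, fun _ h => h.elim⟩).mono ?_
  rintro τ k hτ ⟨hk, Q₁, sd₁, hQ₁, ⟨hC₁, hpre, hext, -⟩, hsee⟩
  have e3 : output n τ = output n σ := by
    unfold output; rw [hτ 3 (by decide)]
  have := wp_scan (x := 22) (y := 20) (Or.inr ⟨rfl, rfl⟩)
    (hσ.congr (τ := τ) (fun a ha => hτ a (by revert a; decide)))
    (by rw [hτ 22 (by decide), hr]) (by rw [hτ 20 (by decide), hu])
    (by rw [hτ 9 (by decide), ht]) (by rw [hτ 21 (by decide), hs]) hs'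
    (fun Q' sd' => G.ClosureState (output n σ) x₁ x₂ y₁ y₂ Q' sd' ∧ Q <+: Q' ∧
      (∀ w, sd w ≠ 0 → sd' w = sd w) ∧ ∀ w : Fin n, (w ∈ output n σ ∧ G.SeesOnly u r w) → sd' w ≠ 0)
    (by rw [e3]; exact step _ r u hur rfl) hQ₁ ⟨hC₁, hpre, hext, fun w hw => hsee w hw.1 hw.2⟩
  refine this.mono ?_
  rintro υ k' hυ ⟨hk', Q₂, sd₂, hQ₂, ⟨hC₂, hpre₂, hext₂, hP⟩, hsee₂⟩
  refine ⟨by omega, Q₂, sd₂, hQ₂, hC₂, hpre₂, hext₂, ?_⟩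
  rintro v hv (h | h)
  · exact hP v ⟨hv, h⟩
  · exact hsee₂ v (e3 ▸ hv) h

theorem wp_closureStep {t : ℕ} {σ : Mem} {x₁ x₂ y₁ y₂ : Fin n}
    (hσ : Holds G es D σ) (ht : σ 9 0 = t) (hx : σ 11 0 = x₁) (hy : σ 13 0 = y₁)
    (hok : σ 19 0 ≠ 0) {Q : List (Fin n)} {sd : Fin n → ℕ} (hQ : QueueState t σ Q sd)
    (hC : G.ClosureState (output n σ) x₁ x₂ y₁ y₂ Q sd) (hlt : σ 17 0 < Q.length)
    (hP : G.Processed (output n σ) x₁ y₁ (Q.take (σ 17 0)) sd) (hD : σ 17 0 ≤ 2 * D + 2) :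
    WP closureStep σ fun τ k => k ≤ 600 * (D + 1) ∧ τ 17 0 = σ 17 0 + 1 ∧
      ClosureInv G t (output n σ) x₁ x₂ y₁ y₂ τ := by
  obtain ⟨h, hh⟩ : ∃ h, σ 17 0 = h := ⟨_, rfl⟩
  rw [hh] at hlt hP hD ⊢
  obtain ⟨u, hu⟩ : ∃ u, Q[h] = u := ⟨_, rfl⟩
  have huQ : u ∈ Q := hu ▸ List.getElem_mem hlt
  have hsu : sd u = 1 ∨ sd u = 2 := by
    have := (hC.mem_iff u).1 huQ
    have := hC.side_le u
    omega
  have tk : Q.take (h + 1) = Q.take h ++ [u] := by simp [← hu]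
  simp only [closureStep, wp_seq, wp_assign, Expr.eval, Expr.cost, Mem.store_self_apply, if_true,
    Mem.store_of_ne (show (0 : ℕ) ≠ 20 by decide), Mem.store_of_ne (show (9 : ℕ) ≠ 20 by decide),
    Mem.store_of_ne (show (7 : ℕ) ≠ 20 by decide)]
  rw [hh, hQ.queue h hlt, hu, ht, hσ.num, hQ.side]
  obtain ⟨σ₁, hσ₁⟩ : ∃ σ₁, (σ.store 20 0 u).store 21 0 (sd u) = σ₁ := ⟨_, rfl⟩
  rw [hσ₁]
  have f₁ : ∀ a, a ≠ 20 → a ≠ 21 → σ₁ a = σ a := by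
    intro a h1 h2
    rw [← hσ₁, Mem.store_of_ne h2, Mem.store_of_ne h1]
  have hu₁ : σ₁ 20 0 = u := by
    rw [← hσ₁, Mem.store_of_ne (by decide), Mem.store_self_apply, if_pos rfl]
  have hs₁ : σ₁ 21 0 = sd u := by rw [← hσ₁, Mem.store_self_apply, if_pos rfl]
  have href : WP (.ite (.sub (var 21) (.lit 1)) (setVar 22 (var 13)) (setVar 22 (var 11))) σ₁
      fun υ k => k ≤ 20 ∧ ∃ r : Fin n, υ 22 0 = r ∧ (sd u = 1 ∧ r = x₁ ∨ sd u = 2 ∧ r = y₁) := by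
    simp only [wp_ite, wp_assign, Expr.eval, Expr.cost, Mem.store_self_apply, if_true]
    rw [f₁ 13 (by decide) (by decide), f₁ 11 (by decide) (by decide), hx, hy, hs₁]
    exact ⟨fun e => ⟨by omega, y₁, rfl, Or.inr ⟨by omega, rfl⟩⟩,
      fun e => ⟨by omega, x₁, rfl, Or.inl ⟨by omega, rfl⟩⟩⟩
  refine href.mono ?_
  rintro σ₂ k₂ hσ₂ ⟨hk₂, r, hr, hrc⟩
  have f₂ : ∀ a, a ≠ 20 → a ≠ 21 → a ≠ 22 → σ₂ a = σ a := by
    intro a h1 h2 h3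
    rw [hσ₂ a (by simpa [Program.writes] using h3), f₁ a h1 h2]
  have hsr : sd r = sd u := by
    rcases hrc with ⟨e, rfl⟩ | ⟨e, rfl⟩
    · rw [e, hC.side_x₁]
    · rw [e, hC.side_y₁]
  have hHolds₂ : Holds G es D σ₂ := hσ.congr fun a ha => by
    refine f₂ a ?_ ?_ ?_ <;> rintro rfl <;> revert ha <;> decide
  have hQ₂ : QueueState t σ₂ Q sd := hQ.congr (f₂ 7 (by decide) (by decide) (by decide))
    (f₂ 8 (by decide) (by decide) (by decide)) (f₂ 18 (by decide) (by decide) (by decide))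
  have ht₂ : σ₂ 9 0 = t := by rw [f₂ 9 (by decide) (by decide) (by decide), ht]
  have hu₂ : σ₂ 20 0 = u := by rw [hσ₂ 20 (by decide), hu₁]
  have hs₂ : σ₂ 21 0 = sd u := by rw [hσ₂ 21 (by decide), hs₁]
  refine (wp_checkClique hHolds₂ ht₂ hu₂ hs₂
    (by rw [f₂ 17 (by decide) (by decide) (by decide), hh])
    (by rw [f₂ 19 (by decide) (by decide) (by decide)]; exact hok) hQ₂ hlt.le).mono ?_
  rintro σ₃ k₃ hσ₃ ⟨hk₃, hok₃, hfail₃⟩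
  have hHolds₃ : Holds G es D σ₃ := hHolds₂.congr fun a ha => hσ₃ a (by revert a; decide)
  have hQ₃ : QueueState t σ₃ Q sd := hQ₂.congr (hσ₃ 7 (by decide)) (hσ₃ 8 (by decide))
    (hσ₃ 18 (by decide))
  have hS₃ : output n σ₃ = output n σ := by
    unfold output
    rw [hσ₃ 3 (by decide), f₂ 3 (by decide) (by decide) (by decide)]
  have h17₃ : σ₃ 17 0 = h := by
    rw [hσ₃ 17 (by decide), f₂ 17 (by decide) (by decide) (by decide), hh]
  have hscan : WP (.ite (var 19) (.seq (scan 20 22) (scan 22 20)) .skip) σ₃ fun τ k =>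
      k ≤ 240 * (D + 1) + 10 ∧ ∃ Q' sd',
      QueueState t τ Q' sd' ∧ G.ClosureState (output n σ) x₁ x₂ y₁ y₂ Q' sd' ∧ Q <+: Q' ∧
      (∀ w, sd w ≠ 0 → sd' w = sd w) ∧ (σ₃ 19 0 ≠ 0 →
      ∀ v ∈ output n σ, G.SeesOnly u r v ∨ G.SeesOnly r u v → sd' v ≠ 0) := by
    rw [wp_ite]
    constructor
    · intro _
      refine (wp_scan_scan hHolds₃ (by rw [hσ₃ 9 (by decide), ht₂])
        (by rw [hσ₃ 20 (by decide), hu₂]) (by rw [hσ₃ 22 (by decide), hr])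
        (by rw [hσ₃ 21 (by decide), hs₂]) hsu hsr hQ₃ (by rw [hS₃]; exact hC)).mono ?_
      rintro τ k - ⟨hk, Q', sd', h1, h2, h3, h4, h5⟩
      rw [hS₃] at h2 h5
      simp only [Expr.cost]
      exact ⟨by omega, Q', sd', h1, h2, h3, h4, fun _ => h5⟩
    · intro h0
      rw [wp_skip]
      simp only [Expr.cost]
      exact ⟨by omega, Q, sd, hQ₃, hC, List.prefix_rfl, fun _ _ => rfl, fun e => absurd h0 e⟩
  refine hscan.mono ?_
  rintro σ₄ k₄ hσ₄ ⟨hk₄, Q', sd', hQ', hC', ⟨R, rfl⟩, hext, hsee⟩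
  rw [hσ₄ 17 (by decide), h17₃]
  have hok₄ : (σ₄.store 17 0 (h + 1)) 19 0 = σ₃ 19 0 := by
    rw [Mem.store_of_ne (by decide), hσ₄ 19 (by decide)]
  refine ⟨by omega, rfl, Q ++ R, sd', hQ'.congr (Mem.store_of_ne (by decide) _ _)
    (Mem.store_of_ne (by decide) _ _) (Mem.store_of_ne (by decide) _ _), hC', ?_, ?_, ?_⟩
  · rw [Mem.store_self_apply, if_pos rfl, List.length_append]; omega
  · rw [hok₄, Mem.store_self_apply, if_pos rfl, List.take_append_of_le_length (by omega), tk]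
    intro ok
    have sdQ : ∀ w ∈ Q.take h ++ [u], sd' w = sd w := by
      intro w hw
      refine hext w ((hC.mem_iff w).1 ?_)
      rcases List.mem_append.1 hw with hw | hw
      · exact List.mem_of_mem_take hw
      · rw [List.mem_singleton.1 hw]; exact huQ
    constructor
    · intro a ha b hb hne hsab
      rw [sdQ a ha, sdQ b hb] at hsab
      rcases List.mem_append.1 ha with ha | ha <;> rcases List.mem_append.1 hb with hb | hb
      · exact hP.clique a ha b hb hne hsab
      · rw [List.mem_singleton.1 hb] at hsab hne ⊢
        exact ((hok₃ ok a ha hsab).resolve_left hne.symm).symm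
      · rw [List.mem_singleton.1 ha] at hsab hne ⊢
        exact (hok₃ ok b hb hsab.symm).resolve_left hne
      · rw [List.mem_singleton.1 ha, List.mem_singleton.1 hb] at hne
        exact absurd rfl hne
    · intro a ha r' hr' v hv hs
      rw [sdQ a ha] at hr'
      rcases List.mem_append.1 ha with ha | ha
      · have := hP.closed a ha r' hr' v hv hs
        rwa [hext v this]
      · rw [List.mem_singleton.1 ha] at hr' hs
        -- The side of `u` is either `1` or `2`, so it determines the representative.
        have : r' = r := by
          rcases hr' with ⟨e, rfl⟩ | ⟨e, rfl⟩ <;> rcases hrc with ⟨e', rfl⟩ | ⟨e', rfl⟩ <;>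
            first | rfl | omega
        subst this
        exact hsee ok v hv hs
  · rw [hok₄]
    intro hf X Y hXY
    -- The failed test exhibits two distinct non-adjacent vertices that every candidate pair would
    -- have to place in the same clique.
    obtain ⟨w, hw, hws, hn⟩ := hfail₃ hf
    have hw' := hC.forced X Y hXY w
    have hu' := hC.forced X Y hXY u
    rcases hsu with e | e
    · exact hn (or_iff_not_imp_left.2 (hXY.clique_left _ (hu'.1 e) _ (hw'.1 (hws.trans e))))
    · exact hn (or_iff_not_imp_left.2 (hXY.clique_right _ (hu'.2 e) _ (hw'.2 (hws.trans e))))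

theorem wp_closureLoop [DecidableRel G.Adj] {t : ℕ} {σ : Mem} {x₁ x₂ y₁ y₂ : Fin n}
    (hσ : Holds G es D σ) (hdeg : ∀ v, G.degree v ≤ D)
    (ht : σ 9 0 = t) (hx : σ 11 0 = x₁) (hy : σ 13 0 = y₁)
    (hI : ClosureInv G t (output n σ) x₁ x₂ y₁ y₂ σ) :
    WP closureLoop σ fun τ k => k ≤ 2000 * (D + 1) ^ 2 ∧
      ClosureInv G t (output n σ) x₁ x₂ y₁ y₂ τ ∧ (τ 18 0 - τ 17 0) * τ 19 0 = 0 := by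
  -- As long as the flag is up, the processed prefix has length at most `2 * D + 2`, so the measure
  -- decreases in each round, including one in which the clique test fails.
  refine wp_loop (600 * (D + 1)) (fun τ => (∀ a, a ∉ closureStep.writes → τ a = σ a) ∧
    ClosureInv G t (output n σ) x₁ x₂ y₁ y₂ τ) (fun τ => 2 * D + 3 - τ 17 0) ?_ ⟨fun _ _ => rfl, hI⟩ ?_
  · rintro τ ⟨hτ, Q, sd, hQ, hC, hle, hP, hf⟩ hc
    simp only [Expr.eval] at hc
    have hok : τ 19 0 ≠ 0 := fun e => hc (by rw [e, mul_zero])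
    have hlt : τ 17 0 < τ 18 0 := by
      by_contra hn
      exact hc (by rw [show τ 18 0 - τ 17 0 = 0 by omega, zero_mul])
    rw [hQ.tail] at hlt
    have hP := hP hok
    have hS : output n τ = output n σ := by
      unfold output; rw [hτ 3 (by decide)]
    have hD := hP.length_le hdeg hC (List.take_sublist _ _)
    rw [List.length_take, min_eq_left hlt.le] at hD
    rw [← hS] at hC hP ⊢
    refine (wp_closureStep (hσ.congr fun a ha => hτ a (by revert a; decide))
      (by rw [hτ 9 (by decide), ht]) (by rw [hτ 11 (by decide), hx])
      (by rw [hτ 13 (by decide), hy]) hok hQ hC hlt hP hD).mono ?_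
    rintro υ k hυ ⟨hk, h17, hI⟩
    exact ⟨hk, ⟨fun a ha => by rw [hυ a ha, hτ a ha], hI⟩, by omega⟩
  · rintro τ k ⟨hτ, hI⟩ hc hk
    simp only [Expr.eval, Expr.cost] at hc hk
    refine ⟨hk.trans ?_, hI, hc⟩
    have := Nat.mul_le_mul_right (600 * (D + 1) + (1 + 1 + (1 + 1) + 1 + (1 + 1) + 1) + 1)
      (Nat.sub_le (2 * D + 3) (σ 17 0))
    nlinarith

end RAM

/-! ### Starting the closure from a four-cycle -/

namespace SimpleGraph

variable {V : Type*} {G : SimpleGraph V} {S : Set V} {x₁ x₂ y₁ y₂ z₁ z₂ : V}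

namespace NonlinearPairOn

variable {X Y : Set V}

theorem seesOnly (h : G.NonlinearPairOn S X Y x₁ x₂ y₁ y₂) : G.SeesOnly x₁ x₂ y₁ :=
  ⟨h.adj₁, by
    rintro (e | e)
    exacts [h.disjoint _ h.mem_x₂ (e ▸ h.mem_y₁), h.not_adj₂ e]⟩

/-- The two vertices in `Y` can be replaced by any that tell `x₁` from `x₂`. -/
theorem replace (h : G.NonlinearPairOn S X Y x₁ x₂ y₁ y₂) (hz₁ : z₁ ∈ S) (hz₂ : z₂ ∈ S)
    (h₁ : G.SeesOnly x₁ x₂ z₁) (h₂ : G.SeesOnly x₂ x₁ z₂) :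
    G.NonlinearPairOn S X Y x₁ x₂ z₁ z₂ :=
  { h with
    mem_y₁ := h.mem_right_of_seesOnly h.mem_x₁ h.mem_x₂ hz₁ h₁
    mem_y₂ := h.mem_right_of_seesOnly h.mem_x₂ h.mem_x₁ hz₂ h₂
    adj₁ := h₁.1
    adj₂ := h₂.1
    not_adj₁ := fun e => h₂.2 (Or.inr e)
    not_adj₂ := fun e => h₁.2 (Or.inr e) }

end NonlinearPairOn

theorem ClosureState.start [DecidableEq V] (hx₁ : x₁ ∈ S) (hx₂ : x₂ ∈ S) (hy₁ : y₁ ∈ S)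
    (hy₂ : y₂ ∈ S) (hx : x₁ ≠ x₂) (h₁ : G.SeesOnly x₁ x₂ y₁) (h₂ : G.SeesOnly x₂ x₁ y₂) :
    G.ClosureState S x₁ x₂ y₁ y₂ [x₁, x₂, y₁, y₂] (Function.update (Function.update
      (Function.update (Function.update (fun _ => 0) x₁ 1) x₂ 1) y₁ 2) y₂ 2) := by
  have a : x₁ ≠ y₁ := h₁.1.ne
  have b : x₂ ≠ y₂ := h₂.1.ne
  have c : x₂ ≠ y₁ := fun e => h₁.2 (Or.inl e)
  have d : x₁ ≠ y₂ := fun e => h₂.2 (Or.inl e)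
  have e : y₁ ≠ y₂ := by rintro rfl; exact h₂.2 (Or.inr h₁.1)
  refine ⟨by simp [*], ?_, ?_, ?_, by simp [*], by simp [*], by simp [*], by simp [*], ?_⟩
  · intro v
    simp only [List.mem_cons, List.not_mem_nil, or_false, Function.update_apply]
    split_ifs <;> simp [*]
  · intro v
    simp only [Function.update_apply]
    split_ifs <;> omega
  · intro v hv
    simp only [List.mem_cons, List.not_mem_nil, or_false] at hv
    rcases hv with rfl | rfl | rfl | rfl <;> assumption
  · intro X Y h v
    simp only [Function.update_apply]
    split_ifs with e₁ e₂ e₃ e₄ <;> subst_vars <;> simp [h.mem_x₁, h.mem_x₂, h.mem_y₁, h.mem_y₂]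

end SimpleGraph

/-! ### Processing one edge -/

namespace RAM
variable {n : ℕ} {G : SimpleGraph (Fin n)} {es : List (Fin n × Fin n)} {D : ℕ}

theorem wp_pushVar {a t s : ℕ} {σ : Mem} {Q : List (Fin n)} {sd : Fin n → ℕ} {v : Fin n}
    (h : QueueState t σ Q sd) (hn : σ 0 0 = n) (ht : σ 9 0 = t) (hv : σ a 0 = v)
    (hs : σ 21 0 = s) :
    WP (pushVar a) σ fun τ k =>
      k ≤ 40 ∧ QueueState t τ (Q ++ [v]) (Function.update sd v (3 - s)) := by
  rw [pushVar, wp_seq, wp_assign]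
  simp only [Expr.eval, Expr.cost]
  refine (wp_push (σ := σ.store 23 0 (σ a 0)) (t := t) (s := s) (Q := Q) (sd := sd) (v := v) ?_ hn ht ?_ hs).mono ?_
  · exact h.congr rfl rfl rfl
  · rw [Mem.store_self_apply, if_pos rfl, hv]
  · rintro τ k - ⟨hk, hQ⟩
    exact ⟨by omega, hQ⟩

theorem wp_startQueue {t : ℕ} {σ : Mem} {x₁ x₂ y₁ y₂ : Fin n} (hn : σ 0 0 = n) (ht : σ 9 0 = t)
    (hσx₁ : σ 11 0 = x₁) (hσx₂ : σ 12 0 = x₂) (hσy₁ : σ 13 0 = y₁) (hσy₂ : σ 14 0 = y₂)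
    (clean : ∀ t' ≥ t, ∀ v : Fin n, σ 7 (t' * n + v) = 0)
    (hx₁ : x₁ ∈ output n σ) (hx₂ : x₂ ∈ output n σ) (hy₁ : y₁ ∈ output n σ) (hy₂ : y₂ ∈ output n σ)
    (hx : x₁ ≠ x₂) (h₁ : G.SeesOnly x₁ x₂ y₁) (h₂ : G.SeesOnly x₂ x₁ y₂) :
    WP startQueue σ fun τ k => k ≤ 300 ∧ ClosureInv G t (output n σ) x₁ x₂ y₁ y₂ τ := by
  simp only [startQueue, wp_seq, wp_assign]
  simp only [Expr.eval, Expr.cost]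
  obtain ⟨σ₁, hσ₁⟩ : ∃ σ₁, (((σ.store 17 0 0).store 18 0 0).store 19 0 1).store 21 0 2 = σ₁ :=
    ⟨_, rfl⟩
  rw [hσ₁]
  have f₁ : ∀ a, a ≠ 17 → a ≠ 18 → a ≠ 19 → a ≠ 21 → σ₁ a = σ a := by
    intro a h1 h2 h3 h4
    rw [← hσ₁, Mem.store_of_ne h4, Mem.store_of_ne h3, Mem.store_of_ne h2, Mem.store_of_ne h1]
  have e17 : σ₁ 17 0 = 0 := by rw [← hσ₁]; rfl
  have e18 : σ₁ 18 0 = 0 := by rw [← hσ₁]; rfl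
  have e19 : σ₁ 19 0 = 1 := by rw [← hσ₁]; rfl
  -- A push uses the side opposite to variable `21`, so this variable is `2` while `x₁`, `x₂` enter
  -- the queue and `1` for `y₁`, `y₂`.
  have e21 : σ₁ 21 0 = 2 := by rw [← hσ₁]; rfl
  have e7 : σ₁ 7 = σ 7 := f₁ 7 (by decide) (by decide) (by decide) (by decide)
  have hQ₁ : QueueState t σ₁ ([] : List (Fin n)) (fun _ => 0) := by
    refine ⟨e18, by simp, ?_, ?_⟩
    · rw [e7]; exact clean t le_rfl
    · rw [e7]; exact fun t' ht' => clean t' (le_of_lt ht')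
  refine (wp_pushVar hQ₁ (v := x₁) (s := 2)
    (by rw [f₁ 0 (by decide) (by decide) (by decide) (by decide), hn])
    (by rw [f₁ 9 (by decide) (by decide) (by decide) (by decide), ht])
    (by rw [f₁ 11 (by decide) (by decide) (by decide) (by decide), hσx₁]) e21).mono ?_
  rintro σ₂ k₂ hσ₂ ⟨hk₂, hQ₂⟩
  have f₂ : ∀ a ∈ [0, 9, 11, 12, 13, 14], σ₂ a = σ a := by
    intro a ha
    rw [hσ₂ a (by revert a; decide)]
    refine f₁ a ?_ ?_ ?_ ?_ <;> revert a <;> decide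
  refine (wp_pushVar hQ₂ (v := x₂) (s := 2) (by rw [f₂ 0 (by decide), hn])
    (by rw [f₂ 9 (by decide), ht]) (by rw [f₂ 12 (by decide), hσx₂])
    (by rw [hσ₂ 21 (by decide), e21])).mono ?_
  rintro σ₃ k₃ hσ₃ ⟨hk₃, hQ₃⟩
  have f₃ : ∀ a ∈ [0, 9, 11, 12, 13, 14], σ₃ a = σ a := by
    intro a ha
    rw [hσ₃ a (by revert a; decide), f₂ a ha]
  obtain ⟨σ₄, hσ₄⟩ : ∃ σ₄, σ₃.store 21 0 1 = σ₄ := ⟨_, rfl⟩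
  rw [hσ₄]
  have f₄ : ∀ a, a ≠ 21 → σ₄ a = σ₃ a := by
    intro a ha
    rw [← hσ₄, Mem.store_of_ne ha]
  have e21' : σ₄ 21 0 = 1 := by rw [← hσ₄]; rfl
  refine (wp_pushVar (hQ₃.congr (f₄ 7 (by decide)) (f₄ 8 (by decide)) (f₄ 18 (by decide)))
    (v := y₁) (s := 1) (by rw [f₄ 0 (by decide), f₃ 0 (by decide), hn])
    (by rw [f₄ 9 (by decide), f₃ 9 (by decide), ht])
    (by rw [f₄ 13 (by decide), f₃ 13 (by decide), hσy₁]) e21').mono ?_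
  rintro σ₅ k₅ hσ₅ ⟨hk₅, hQ₅⟩
  have f₅ : ∀ a ∈ [0, 9, 14], σ₅ a = σ a := by
    intro a ha
    rw [hσ₅ a (by revert a; decide), f₄ a (by revert a; decide), f₃ a (by revert a; decide)]
  refine (wp_pushVar hQ₅ (v := y₂) (s := 1) (by rw [f₅ 0 (by decide), hn])
    (by rw [f₅ 9 (by decide), ht]) (by rw [f₅ 14 (by decide), hσy₂])
    (by rw [hσ₅ 21 (by decide), e21'])).mono ?_
  rintro σ₆ k₆ hσ₆ ⟨hk₆, hQ₆⟩
  have e17' : σ₆ 17 0 = 0 := by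
    rw [hσ₆ 17 (by decide), hσ₅ 17 (by decide), f₄ 17 (by decide), hσ₃ 17 (by decide),
      hσ₂ 17 (by decide), e17]
  have e19' : σ₆ 19 0 = 1 := by
    rw [hσ₆ 19 (by decide), hσ₅ 19 (by decide), f₄ 19 (by decide), hσ₃ 19 (by decide),
      hσ₂ 19 (by decide), e19]
  refine ⟨by omega, _, _, hQ₆, ?_, ?_, ?_, ?_⟩
  · exact SimpleGraph.ClosureState.start hx₁ hx₂ hy₁ hy₂ hx h₁ h₂
  · rw [e17']; exact Nat.zero_le _
  · rw [e17']
    exact fun _ => ⟨by simp, by simp⟩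
  · rw [e19']; exact fun h => absurd h one_ne_zero

theorem wp_reduce {t : ℕ} {σ : Mem} {x₁ y₁ y₂ : Fin n}
    (hσx₁ : σ 11 0 = x₁) (hσy₁ : σ 13 0 = y₁) (hσy₂ : σ 14 0 = y₂)
    {Q : List (Fin n)} {sd : Fin n → ℕ} (hQ : QueueState t σ Q sd) :
    WP reduce σ fun τ k => k ≤ 40 * (Q.length + 1) ∧
      output n τ = {v | v ∈ output n σ ∧ v ∉ Q ∨ v = x₁ ∨ v = y₁ ∨ v = y₂} := by
  rw [reduce, wp_seq]
  refine wp_forLoop Q.length 10 (fun k τ => ∀ v : Fin n, τ 3 v ≠ 0 ↔ v ∈ output n σ ∧ v ∉ Q.take k)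
    (by decide) ?_ ?_ ?_ ?_ ?_
  · intro τ hτ
    simp only [Expr.eval]
    rw [hτ 18 (by decide), hQ.tail]
  · exact fun _ _ _ h => h
  · intro v
    simp [output]
  · intro k hk τ hτ hk' hI
    rw [wp_assign]
    simp only [Expr.eval, Expr.cost]
    rw [hτ 8 (by decide), hk', hQ.queue k hk]
    refine ⟨by omega, ?_⟩
    intro v
    have tk : Q.take (k + 1) = Q.take k ++ [Q[k]] := by simp
    rw [Mem.store_self_apply, tk, List.mem_append, List.mem_singleton]
    by_cases e : v = Q[k]
    · simp [e]
    · rw [if_neg (fun h => e (Fin.ext h)), hI v]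
      simp [e]
  · intro τ k hτ hI hk
    simp only [wp_seq, wp_assign, Expr.eval, Expr.cost,
      Mem.store_of_ne (show (13 : ℕ) ≠ 3 by decide), Mem.store_of_ne (show (14 : ℕ) ≠ 3 by decide)] at hk ⊢
    rw [hτ 11 (by decide), hτ 13 (by decide), hτ 14 (by decide), hσx₁, hσy₁, hσy₂]
    refine ⟨by omega, ?_⟩
    ext v
    have := hI v
    rw [List.take_length] at this
    simp only [output, Set.mem_ofPred_eq, Mem.store_self_apply, ← Fin.ext_iff] at this ⊢
    by_cases h1 : v = y₂
    · simp [h1]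
    by_cases h2 : v = y₁
    · simp [h2]
    by_cases h3 : v = x₁
    · simp [h3]
    simp only [h1, h2, h3, if_false, or_false]
    exact this

/-- What happens to the set of vertices that are left when the edge `x₁x₂` is processed. -/
def EdgeStep (G : SimpleGraph (Fin n)) (x₁ x₂ : Fin n) (S S' : Set (Fin n)) : Prop :=
  (S' = S ∧ ∀ X Y y₁ y₂, ¬ G.NonlinearPairOn S X Y x₁ x₂ y₁ y₂) ∨
  ∃ X Y y₁ y₂, G.NonlinearPairOn S X Y x₁ x₂ y₁ y₂ ∧ S' = SimpleGraph.shrink S X Y x₁ y₁ y₂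

theorem wp_closure_reduce [DecidableRel G.Adj] {t : ℕ} {σ : Mem} {x₁ x₂ y₁ y₂ : Fin n}
    (hσ : Holds G es D σ) (hdeg : ∀ v, G.degree v ≤ D) (ht : σ 9 0 = t)
    (hσx₁ : σ 11 0 = x₁) (hσx₂ : σ 12 0 = x₂) (hσy₁ : σ 13 0 = y₁) (hσy₂ : σ 14 0 = y₂)
    (clean : ∀ t' ≥ t, ∀ v : Fin n, σ 7 (t' * n + v) = 0)
    (hx₁ : x₁ ∈ output n σ) (hx₂ : x₂ ∈ output n σ) (hy₁ : y₁ ∈ output n σ) (hy₂ : y₂ ∈ output n σ)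
    (hx : x₁ ≠ x₂) (h₁ : G.SeesOnly x₁ x₂ y₁) (h₂ : G.SeesOnly x₂ x₁ y₂) :
    WP (.seq startQueue (.seq closureLoop (.ite (var 19) reduce .skip))) σ fun τ k =>
      k ≤ 2600 * (D + 1) ^ 2 ∧ (∀ t' ≥ t + 1, ∀ v : Fin n, τ 7 (t' * n + v) = 0) ∧
      EdgeStep G x₁ x₂ (output n σ) (output n τ) := by
  rw [wp_seq]
  refine (wp_startQueue hσ.num ht hσx₁ hσx₂ hσy₁ hσy₂ clean hx₁ hx₂ hy₁ hy₂ hx h₁ h₂).mono ?_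
  rintro σ₁ k₁ f₁ ⟨hk₁, hI₁⟩
  have hS₁ : output n σ₁ = output n σ := by unfold output; rw [f₁ 3 (by decide)]
  rw [wp_seq]
  refine (wp_closureLoop (hσ.congr fun a ha => f₁ a (by revert a; decide)) hdeg
    (by rw [f₁ 9 (by decide), ht]) (by rw [f₁ 11 (by decide), hσx₁])
    (by rw [f₁ 13 (by decide), hσy₁]) (hS₁.symm ▸ hI₁)).mono ?_
  rintro σ₂ k₂ f₂ ⟨hk₂, ⟨Q, sd, hQ, hC, hle, hP, hfail⟩, hc⟩
  rw [hS₁] at hC hP hfail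
  have hS₂ : output n σ₂ = output n σ := by
    unfold output; rw [f₂ 3 (by decide), f₁ 3 (by decide)]
  have hD1 : D + 1 ≤ (D + 1) ^ 2 := Nat.le_self_pow two_ne_zero _
  rw [wp_ite]
  simp only [Expr.eval, Expr.cost]
  constructor
  · intro hok
    -- The loop stopped with the flag still up, so the whole queue has been processed.
    have hlen : Q.length ≤ σ₂ 17 0 := by
      rcases Nat.mul_eq_zero.1 hc with h | h
      · rw [hQ.tail] at h; omega
      · exact absurd h hok
    have hP := hP hok
    rw [List.take_of_length_le hlen] at hP
    have hNP := hC.nonlinearPairOn hP h₁.1 h₂.1 (fun e => h₂.2 (Or.inr e))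
      (fun e => h₁.2 (Or.inr e))
    have hlen' := hP.length_le hdeg hC (List.Sublist.refl _)
    refine (wp_reduce (x₁ := x₁) (y₁ := y₁) (y₂ := y₂) (by rw [f₂ 11 (by decide), f₁ 11 (by decide), hσx₁])
      (by rw [f₂ 13 (by decide), f₁ 13 (by decide), hσy₁])
      (by rw [f₂ 14 (by decide), f₁ 14 (by decide), hσy₂]) hQ).mono ?_
    rintro τ k fτ ⟨hk, hS⟩
    refine ⟨by omega, ?_, Or.inr ⟨_, _, y₁, y₂, hNP, ?_⟩⟩
    · rw [fτ 7 (by decide)]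
      exact fun t' ht' => hQ.clean t' (by omega)
    · rw [hS, hS₂]
      ext v
      have h1 := hC.mem_iff v
      have h2 := hC.side_le v
      have h3 : v ∉ Q ↔ ¬ sd v = 1 ∧ ¬ sd v = 2 := by rw [h1]; omega
      simp only [SimpleGraph.shrink, Set.mem_ofPred_eq, h3]
  · intro hok
    rw [wp_skip]
    refine ⟨by omega, fun t' ht' => hQ.clean t' (by omega), Or.inl ⟨hS₂, ?_⟩⟩
    intro X Y z₁ z₂ h
    -- The search was run for one choice of `y₁`, `y₂`; a pair for any other choice would also be a
    -- pair for this one.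
    exact hfail hok X Y (h.replace hy₁ hy₂ h₁ h₂)

theorem wp_processEdge [DecidableRel G.Adj] {t : ℕ} {σ : Mem} {x₁ x₂ : Fin n}
    (hσ : Holds G es D σ) (hdeg : ∀ v, G.degree v ≤ D) (ht : σ 9 0 = t)
    (hσx₁ : σ 1 t = x₁) (hσx₂ : σ 2 t = x₂)
    (clean : ∀ t' ≥ t, ∀ v : Fin n, σ 7 (t' * n + v) = 0) (hx : x₁ ≠ x₂) :
    WP processEdge σ fun τ k =>
      k ≤ 3000 * (D + 1) ^ 2 ∧ (∀ t' ≥ t + 1, ∀ v : Fin n, τ 7 (t' * n + v) = 0) ∧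
      EdgeStep G x₁ x₂ (output n σ) (output n τ) := by
  have hD1 : D + 1 ≤ (D + 1) ^ 2 := Nat.le_self_pow two_ne_zero _
  have hD0 : 1 ≤ (D + 1) ^ 2 := Nat.one_le_pow _ _ (by omega)
  simp only [processEdge, wp_seq (p := setVar _ _), wp_assign]
  simp only [Expr.eval, Expr.cost]
  rw [Mem.store_of_ne (show (9 : ℕ) ≠ 11 by decide), Mem.store_of_ne (show (2 : ℕ) ≠ 11 by decide),
    ht, hσx₁, hσx₂]
  obtain ⟨σ₁, hσ₁⟩ : ∃ σ₁, (σ.store 11 0 x₁).store 12 0 x₂ = σ₁ := ⟨_, rfl⟩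
  rw [hσ₁]
  have f₁ : ∀ a, a ≠ 11 → a ≠ 12 → σ₁ a = σ a := by
    intro a h1 h2
    rw [← hσ₁, Mem.store_of_ne h2, Mem.store_of_ne h1]
  have e11 : σ₁ 11 0 = x₁ := by rw [← hσ₁]; rfl
  have e12 : σ₁ 12 0 = x₂ := by rw [← hσ₁]; rfl
  have e3 : σ₁ 3 = σ 3 := f₁ 3 (by decide) (by decide)
  have hS₁ : output n σ₁ = output n σ := by unfold output; rw [e3]
  have e7 : σ₁ 7 = σ 7 := f₁ 7 (by decide) (by decide)
  have hHolds₁ : Holds G es D σ₁ := hσ.congr fun a ha => by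
    refine f₁ a ?_ ?_ <;> revert a <;> decide
  have clean' : ∀ t' ≥ t + 1, ∀ v : Fin n, σ 7 (t' * n + v) = 0 := fun t' h => clean t' (by omega)
  rw [wp_ite]
  simp only [Expr.eval, Expr.cost]
  rw [e11, e12, e3]
  constructor
  · intro h
    have hx₁ : x₁ ∈ output n σ := left_ne_zero_of_mul h
    have hx₂ : x₂ ∈ output n σ := right_ne_zero_of_mul h
    rw [wp_seq]
    refine (wp_find (by decide) hHolds₁ x₁ x₂ e11 e12).mono ?_
    rintro σ₂ k₂ f₂ ⟨hk₂, hy₁, hn₁⟩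
    rw [hS₁] at hy₁ hn₁
    have hS₂ : output n σ₂ = output n σ := by
      rw [← hS₁]; unfold output; rw [f₂ 3 (by decide)]
    rw [wp_seq]
    refine (wp_find (by decide) (hHolds₁.congr fun a ha => f₂ a (by revert a; decide)) x₂ x₁
      (by rw [f₂ 12 (by decide), e12]) (by rw [f₂ 11 (by decide), e11])).mono ?_
    rintro σ₃ k₃ f₃ ⟨hk₃, hy₂, hn₂⟩
    rw [hS₂] at hy₂ hn₂
    have hS₃ : output n σ₃ = output n σ := by
      rw [← hS₂]; unfold output; rw [f₃ 3 (by decide)]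
    have h7 : σ₃ 7 = σ 7 := by rw [f₃ 7 (by decide), f₂ 7 (by decide), e7]
    have h15 : σ₃ 15 = σ₂ 15 := f₃ 15 (by decide)
    rw [wp_ite]
    simp only [Expr.eval, Expr.cost]
    rw [h15]
    constructor
    · intro h
      obtain ⟨y₁, hσy₁, hy₁S, h₁⟩ := hy₁ (left_ne_zero_of_mul h)
      obtain ⟨y₂, hσy₂, hy₂S, h₂⟩ := hy₂ (right_ne_zero_of_mul h)
      refine (wp_closure_reduce (t := t) (x₁ := x₁) (x₂ := x₂) (y₁ := y₁) (y₂ := y₂)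
        (hHolds₁.congr (τ := σ₃) fun a ha => ?_) hdeg ?_ ?_ ?_ ?_ hσy₂ ?_ ?_ ?_ ?_ ?_ hx h₁ h₂).mono ?_
      · rw [f₃ a (by revert a; decide), f₂ a (by revert a; decide)]
      · rw [f₃ 9 (by decide), f₂ 9 (by decide), f₁ 9 (by decide) (by decide), ht]
      · rw [f₃ 11 (by decide), f₂ 11 (by decide), e11]
      · rw [f₃ 12 (by decide), f₂ 12 (by decide), e12]
      · rw [f₃ 13 (by decide), hσy₁]
      · rw [h7]; exact clean
      · rw [hS₃]; exact hx₁
      · rw [hS₃]; exact hx₂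
      · rw [hS₃]; exact hy₁S
      · rw [hS₃]; exact hy₂S
      · rintro τ k - ⟨hk, hcl, hst⟩
        rw [hS₃] at hst
        exact ⟨by omega, hcl, hst⟩
    · intro h
      rw [wp_skip, h7]
      refine ⟨by omega, clean', Or.inl ⟨hS₃, ?_⟩⟩
      intro X Y y₁ y₂ hNP
      -- A pair on this edge would provide separating vertices in both directions, but one of the
      -- two searches found none.
      rcases Nat.mul_eq_zero.1 h with h0 | h0
      · exact hn₁ h0 y₁ (hNP.subset_right _ hNP.mem_y₁) hNP.seesOnly
      · exact hn₂ h0 y₂ (hNP.subset_right _ hNP.mem_y₂) hNP.flip.seesOnly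
  · intro h
    rw [wp_skip, e7]
    refine ⟨by omega, clean', Or.inl ⟨hS₁, ?_⟩⟩
    intro X Y y₁ y₂ hNP
    rcases Nat.mul_eq_zero.1 h with h0 | h0
    · exact hNP.subset_left _ hNP.mem_x₁ h0
    · exact hNP.subset_left _ hNP.mem_x₂ h0

end RAM

namespace RAM
variable {n : ℕ} {G : SimpleGraph (Fin n)} {es : List (Fin n × Fin n)} {D : ℕ}

/-! ### Reading the graph -/

theorem IsEdgeList.length_eq (h : IsEdgeList G es) : G.edgeSet.ncard = es.length := by
  classical
  have : G.edgeSet = ((es.map fun e => s(e.1, e.2)).toFinset : Set (Sym2 (Fin n))) := by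
    ext e
    rw [← h.2 e]
    simp
  rw [this, Set.ncard_coe_finset, List.toFinset_card_of_nodup h.1, List.length_map]

theorem IsEdgeList.adj (h : IsEdgeList G es) {t : ℕ} (ht : t < es.length) :
    G.Adj es[t].1 es[t].2 := by
  have : s(es[t].1, es[t].2) ∈ es.map fun e => s(e.1, e.2) :=
    List.mem_map.2 ⟨es[t], List.getElem_mem ht, rfl⟩
  exact (h.2 _).1 this

/-- The memory holds the lists of neighbours `A` and the matrix of the closed neighbourhoods. -/
structure NbrState (σ : Mem) (A : Fin n → List (Fin n)) : Prop where
  deg : ∀ u : Fin n, σ 5 u = (A u).length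
  nbr : ∀ (u : Fin n) (i : ℕ) (h : i < (A u).length), σ 6 (i * n + u) = ((A u)[i] : ℕ)
  adj : ∀ u v : Fin n, σ 4 (u * n + v) ≠ 0 ↔ u = v ∨ v ∈ A u

theorem NbrState.congr {σ τ : Mem} {A : Fin n → List (Fin n)} (h : NbrState σ A)
    (h4 : τ 4 = σ 4) (h5 : τ 5 = σ 5) (h6 : τ 6 = σ 6) : NbrState τ A :=
  ⟨by rw [h5]; exact h.deg, by rw [h6]; exact h.nbr, by rw [h4]; exact h.adj⟩

theorem wp_addNbr {x y : ℕ} {σ : Mem} {A : Fin n → List (Fin n)} (hx7 : 7 ≤ x) (hy7 : 7 ≤ y)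
    (h : NbrState σ A) (hn : σ 0 0 = n) {u v : Fin n} (hx : σ x 0 = u) (hy : σ y 0 = v) :
    WP (addNbr x y) σ fun τ k => k ≤ 40 ∧ NbrState τ (Function.update A u (A u ++ [v])) := by
  simp only [addNbr, wp_seq, wp_assign, Expr.eval, Expr.cost]
  simp only [Mem.store_of_ne (show (0 : ℕ) ≠ 4 by decide),
    Mem.store_of_ne (show x ≠ 4 by omega), Mem.store_of_ne (show y ≠ 4 by omega),
    Mem.store_of_ne (show x ≠ 6 by omega), Mem.store_of_ne (show (5 : ℕ) ≠ 4 by decide),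
    Mem.store_of_ne (show (5 : ℕ) ≠ 6 by decide)]
  rw [hx, hy, hn, h.deg]
  refine ⟨by omega, ?_, ?_, ?_⟩
  · intro w
    rw [Mem.store_self_apply, Mem.store_of_ne (by decide), Mem.store_of_ne (by decide)]
    by_cases e : w = u
    · subst e; simp
    · rw [if_neg (fun h => e (Fin.ext h)), Function.update_of_ne e, h.deg]
  · intro w i hi
    rw [Mem.store_of_ne (by decide), Mem.store_self_apply]
    by_cases e : w = u
    · subst e
      simp only [Function.update_self] at hi ⊢
      rw [List.length_append, List.length_singleton] at hi
      by_cases e' : i = (A w).length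
      · subst e'; simp
      · rw [if_neg (fun h => e' (entry_inj.1 h).1), Mem.store_of_ne (by decide),
          h.nbr w i (by omega), List.getElem_append_left (by omega)]
    · simp only [Function.update_of_ne e] at hi ⊢
      rw [if_neg (fun h => e (entry_inj.1 h).2), Mem.store_of_ne (by decide), h.nbr w i hi]
  · intro w z
    rw [Mem.store_of_ne (by decide), Mem.store_of_ne (by decide), Mem.store_self_apply]
    by_cases e : w = u
    · subst e
      by_cases e' : z = v
      · subst e'; simp
      · rw [if_neg (fun h => e' (entry_inj.1 h).2), h.adj]; simp [e']
    · rw [if_neg (fun h => e (Fin.ext (entry_inj.1 h).1)), h.adj, Function.update_of_ne e]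

theorem wp_markAll {σ : Mem} (hn : σ 0 0 = n) (h3 : ∀ i, σ 3 i = 0) (h4 : ∀ i, σ 4 i = 0)
    (h5 : ∀ i, σ 5 i = 0) :
    WP markAll σ fun τ k => k ≤ 40 * (n + 1) ∧ (∀ v, v ∈ output n τ) ∧
      NbrState τ (fun _ : Fin n => []) := by
  refine wp_forLoop n 20 (fun k τ => (∀ v : Fin n, τ 3 v ≠ 0 ↔ (v : ℕ) < k) ∧
    ∀ u v : Fin n, τ 4 (u * n + v) ≠ 0 ↔ u = v ∧ (u : ℕ) < k) (by decide) ?_ ?_ ?_ ?_ ?_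
  · intro τ hτ
    simp only [Expr.eval]
    rw [hτ 0 (by decide), hn]
  · exact fun _ _ _ h => h
  · simp [h3, h4]
  · rintro k hk τ hτ hk' ⟨I3, I4⟩
    simp only [wp_seq, wp_assign, Expr.eval, Expr.cost,
      Mem.store_of_ne (show (10 : ℕ) ≠ 3 by decide), Mem.store_of_ne (show (0 : ℕ) ≠ 3 by decide)]
    rw [hτ 0 (by decide), hk', hn]
    refine ⟨by omega, ?_, ?_⟩
    · intro v
      rw [Mem.store_of_ne (by decide), Mem.store_self_apply]
      split_ifs with e
      · simp; omega
      · rw [I3]; omega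
    · intro u v
      rw [Mem.store_self_apply, Mem.store_of_ne (by decide)]
      have key : (u : ℕ) * n + v = k * n + k ↔ (u : ℕ) = k ∧ v = ⟨k, hk⟩ :=
        entry_inj (a := u) (b := k) (u := v) (v := ⟨k, hk⟩)
      simp only [key, Fin.ext_iff]
      have := I4 u v
      simp only [Fin.ext_iff] at this
      split_ifs with e
      · simp; omega
      · rw [this]; omega
  · rintro τ k hτ ⟨I3, I4⟩ hk
    simp only [Expr.cost] at hk
    refine ⟨by omega, fun v => (I3 v).2 v.isLt, ?_, ?_, ?_⟩
    · intro u; rw [hτ 5 (by decide), h5]; rfl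
    · intro u i h; simp at h
    · intro u v
      rw [I4]
      simp

theorem wp_buildGraph [DecidableRel G.Adj] {σ : Mem} (hdeg : ∀ v, G.degree v ≤ D)
    (hes : IsEdgeList G es) (hn : σ 0 0 = n) (hm : σ 0 1 = es.length)
    (ends : ∀ t (h : t < es.length), σ 1 t = (es[t].1 : ℕ) ∧ σ 2 t = (es[t].2 : ℕ))
    (hσ : NbrState σ (fun _ : Fin n => [])) :
    WP buildGraph σ fun τ k => k ≤ 150 * (es.length + 1) ∧ Holds G es D τ := by
  let f : Fin n × Fin n → Sym2 (Fin n) := fun e => s(e.1, e.2)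
  refine wp_forLoop es.length 100 (fun k τ => ∃ A : Fin n → List (Fin n), NbrState τ A ∧
    ∀ u, (A u).Nodup ∧ ∀ v, v ∈ A u ↔ s(u, v) ∈ (es.take k).map f) (by decide) ?_ ?_ ?_ ?_ ?_
  · intro τ hτ
    simp only [Expr.eval]
    rw [hτ 0 (by decide), hm]
  · exact fun _ _ _ ⟨A, h, h'⟩ => ⟨A, h.congr rfl rfl rfl, h'⟩
  · exact ⟨_, hσ, by simp⟩
  · rintro k hk τ hτ hk' ⟨A, hA, hA'⟩
    obtain ⟨u, hu⟩ : ∃ u, es[k].1 = u := ⟨_, rfl⟩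
    obtain ⟨v, hv⟩ : ∃ v, es[k].2 = v := ⟨_, rfl⟩
    have huv : u ≠ v := by rw [← hu, ← hv]; exact (hes.adj hk).ne
    have tk : (es.take (k + 1)).map f = (es.take k).map f ++ [s(u, v)] := by
      rw [List.take_succ_eq_append_getElem hk, List.map_append]
      simp [f, hu, hv]
    -- Distinctness of the listed edges keeps the neighbour lists free of repetitions, so their
    -- lengths are bounded by the degrees.
    have hnew : s(u, v) ∉ (es.take k).map f := by
      have h1 : ((es.take (k + 1)).map f).Nodup :=
        hes.1.sublist ((List.take_sublist _ _).map _)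
      rw [tk, List.nodup_append] at h1
      exact fun h => h1.2.2 _ h _ (List.mem_singleton_self _) rfl
    have f0 : τ 0 = σ 0 := hτ 0 (by decide)
    have f1 : τ 1 = σ 1 := hτ 1 (by decide)
    have f2 : τ 2 = σ 2 := hτ 2 (by decide)
    simp only [wp_seq (p := setVar _ _), wp_assign]
    simp only [Expr.eval, Expr.cost]
    rw [Mem.store_of_ne (show (9 : ℕ) ≠ 11 by decide), Mem.store_of_ne (show (2 : ℕ) ≠ 11 by decide),
      hk', f1, f2, (ends k hk).1, (ends k hk).2, hu, hv]
    obtain ⟨τ₁, hτ₁⟩ : ∃ τ₁, (τ.store 11 0 u).store 12 0 v = τ₁ := ⟨_, rfl⟩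
    rw [hτ₁, wp_seq]
    have g : ∀ a, a ≠ 11 → a ≠ 12 → τ₁ a = τ a := by
      intro a h1 h2
      rw [← hτ₁, Mem.store_of_ne h2, Mem.store_of_ne h1]
    have e11 : τ₁ 11 0 = u := by rw [← hτ₁]; rfl
    have e12 : τ₁ 12 0 = v := by rw [← hτ₁]; rfl
    have hA₁ : NbrState τ₁ A := hA.congr (g 4 (by decide) (by decide)) (g 5 (by decide) (by decide))
      (g 6 (by decide) (by decide))
    have hn₁ : τ₁ 0 0 = n := by rw [g 0 (by decide) (by decide), f0, hn]
    refine (wp_addNbr (by decide) (by decide) hA₁ hn₁ e11 e12).mono ?_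
    rintro τ₂ k₂ g₂ ⟨hk₂, hA₂⟩
    refine (wp_addNbr (by decide) (by decide) hA₂ (by rw [g₂ 0 (by decide), hn₁])
      (by rw [g₂ 12 (by decide), e12]) (by rw [g₂ 11 (by decide), e11])).mono ?_
    rintro τ₃ k₃ g₃ ⟨hk₃, hA₃⟩
    refine ⟨by omega, _, hA₃, ?_⟩
    rw [Function.update_of_ne huv.symm]
    have hvu : v ∉ A u := fun h => hnew (((hA' u).2 v).1 h)
    have huv' : u ∉ A v := fun h => hnew (Sym2.eq_swap ▸ ((hA' v).2 u).1 h)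
    have ndp : ∀ {L : List (Fin n)} {z : Fin n}, L.Nodup → z ∉ L → (L ++ [z]).Nodup := by
      intro L z h1 h2
      refine List.nodup_append.2 ⟨h1, by simp, ?_⟩
      intro a ha b hb
      rw [List.mem_singleton.1 hb]
      rintro rfl
      exact h2 ha
    intro w
    rw [tk]
    by_cases ev : w = v
    · subst ev
      rw [Function.update_self]
      refine ⟨ndp (hA' w).1 huv', fun z => ?_⟩
      rw [List.mem_append, List.mem_append, (hA' w).2 z, List.mem_singleton, List.mem_singleton]
      refine or_congr Iff.rfl ?_
      rw [Sym2.eq_iff]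
      constructor
      · rintro rfl; exact Or.inr ⟨rfl, rfl⟩
      · rintro (⟨h1, -⟩ | ⟨-, h1⟩)
        exacts [absurd h1.symm huv, h1]
    · rw [Function.update_of_ne ev]
      by_cases eu : w = u
      · subst eu
        rw [Function.update_self]
        refine ⟨ndp (hA' w).1 hvu, fun z => ?_⟩
        rw [List.mem_append, List.mem_append, (hA' w).2 z, List.mem_singleton, List.mem_singleton]
        refine or_congr Iff.rfl ?_
        rw [Sym2.eq_iff]
        constructor
        · rintro rfl; exact Or.inl ⟨rfl, rfl⟩
        · rintro (⟨-, h1⟩ | ⟨h1, -⟩)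
          exacts [h1, absurd h1 ev]
      · rw [Function.update_of_ne eu]
        refine ⟨(hA' w).1, fun z => ?_⟩
        rw [List.mem_append, (hA' w).2 z, List.mem_singleton, Sym2.eq_iff]
        constructor
        · exact Or.inl
        · rintro (h1 | ⟨h1, -⟩ | ⟨h1, -⟩)
          exacts [h1, absurd h1 eu, absurd h1 ev]
  · rintro τ k hτ ⟨A, hA, hA'⟩ hk
    simp only [Expr.cost] at hk
    have mem : ∀ u v, v ∈ A u ↔ G.Adj u v := by
      intro u v
      rw [(hA' u).2 v, List.take_length, hes.2]
      rfl
    refine ⟨by omega, ?_, ?_, ?_, ?_, ?_, ?_, ?_⟩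
    · rw [hτ 0 (by decide), hn]
    · rw [hτ 0 (by decide), hm]
    · rw [hτ 1 (by decide), hτ 2 (by decide)]; exact ends
    · intro u v; rw [hA.adj, mem]
    · intro u i hi
      rw [hA.deg] at hi
      exact ⟨_, hA.nbr u i hi, (mem _ _).1 (List.getElem_mem hi)⟩
    · intro u v huv
      obtain ⟨i, hi, e⟩ := List.getElem_of_mem ((mem u v).2 huv)
      exact ⟨i, by rwa [hA.deg], by rw [hA.nbr u i hi, e]⟩
    · intro u
      rw [hA.deg]
      refine le_trans ?_ (hdeg u)
      rw [← List.toFinset_card_of_nodup (hA' u).1, ← G.card_neighborFinset_eq_degree]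
      refine Finset.card_le_card fun v hv => ?_
      rw [G.mem_neighborFinset]
      exact (mem u v).1 (List.mem_toFinset.1 hv)

/-! ### The whole program -/

/-- The set of vertices that are left after `k` edges. -/
structure Reduced (G : SimpleGraph (Fin n)) (es : List (Fin n × Fin n)) (k : ℕ)
    (S : Set (Fin n)) : Prop where
  holes : ∀ l, Odd l → G.HasHole l → G.HasHoleOn S l
  pairs : ∀ j (h : j < es.length), j < k → ∀ X Y y₁ y₂,
    ¬ G.NonlinearPairOn S X Y es[j].1 es[j].2 y₁ y₂

/-- Earlier edges stay free of pairs because a new pair would lift to the larger set with the same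
four-cycle. An odd hole has length at least five, so shrinking preserves it. -/
theorem Reduced.step {k : ℕ} {S S' : Set (Fin n)} (h : Reduced G es k S) (hk : k < es.length)
    (hS : EdgeStep G es[k].1 es[k].2 S S') : Reduced G es (k + 1) S' := by
  rcases hS with ⟨rfl, hno⟩ | ⟨X, Y, y₁, y₂, hXY, rfl⟩
  · refine ⟨h.holes, fun j hj hjk => ?_⟩
    by_cases e : j = k
    · subst e; exact hno
    · exact h.pairs j hj (by omega)
  · constructor
    · intro l hl hG
      have h1 := h.holes l hl hG
      refine hXY.hasHoleOn_shrink ?_ h1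
      obtain ⟨m, rfl⟩ := hl
      have := h1.1
      omega
    · intro j hj hjk X' Y' z₁ z₂ hNP
      by_cases e : j = k
      · subst e
        -- The current edge is settled because shrinking has deleted its second end.
        rcases hNP.subset_left _ hNP.mem_x₂ with h1 | h1 | h1 | h1
        · exact h1.2.1 hXY.mem_x₂
        · exact hNP.ne_x h1.symm
        · exact hXY.disjoint _ hXY.mem_x₂ (h1 ▸ hXY.mem_y₁)
        · exact hXY.disjoint _ hXY.mem_x₂ (h1 ▸ hXY.mem_y₂)
      · obtain ⟨X₀, Y₀, h0⟩ := hXY.lift hNP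
        exact h.pairs j hj (by omega) X₀ Y₀ z₁ z₂ h0

/-- A surviving pair would have an edge `x₁x₂` in its first clique. The edge list contains it in one
of two orientations, and `flip` covers the reversed one. -/
theorem Reduced.not_nonlinear {S : Set (Fin n)} (h : Reduced G es es.length S)
    (hes : IsEdgeList G es) : ¬ ∃ A B : Set S, (G.induce S).IsNonlinearHomogeneousPair A B := by
  rintro ⟨A, B, hAB⟩
  obtain ⟨X, Y, x₁, x₂, y₁, y₂, hNP⟩ := hAB.exists_on
  have hadj : G.Adj x₁ x₂ := hNP.clique_left _ hNP.mem_x₁ _ hNP.mem_x₂ hNP.ne_x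
  obtain ⟨e, he, hee⟩ := List.mem_map.1 ((hes.2 s(x₁, x₂)).2 hadj)
  obtain ⟨j, hj, rfl⟩ := List.getElem_of_mem he
  rcases Sym2.eq_iff.1 hee with ⟨h1, h2⟩ | ⟨h1, h2⟩
  · exact h.pairs j hj hj X Y y₁ y₂ (by rw [h1, h2]; exact hNP)
  · exact h.pairs j hj hj X Y y₂ y₁ (by rw [h1, h2]; exact hNP.flip)

theorem wp_mainProgram [DecidableRel G.Adj] (hdeg : ∀ v, G.degree v ≤ D) (hes : IsEdgeList G es) :
    WP mainProgram (input n es) fun τ k =>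
      k ≤ 40 * (n + 1) + 150 * (es.length + 1) + es.length * (3000 * (D + 1) ^ 2 + 20) + 20 ∧
      Reduced G es es.length (output n τ) := by
  rw [mainProgram, wp_seq]
  refine (wp_markAll (n := n) rfl (fun _ => rfl) (fun _ => rfl) (fun _ => rfl)).mono ?_
  rintro σ₁ k₁ f₁ ⟨hk₁, hall, hN⟩
  rw [wp_seq]
  refine (wp_buildGraph hdeg hes (by rw [f₁ 0 (by decide)]; rfl) (by rw [f₁ 0 (by decide)]; rfl)
    ?_ hN).mono ?_
  · intro t ht
    rw [f₁ 1 (by decide), f₁ 2 (by decide)]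
    simp [input, ht]
  rintro σ₂ k₂ f₂ ⟨hk₂, hHolds⟩
  refine wp_forLoop es.length (3000 * (D + 1) ^ 2) (fun k τ =>
    (∀ t' ≥ k, ∀ v : Fin n, τ 7 (t' * n + v) = 0) ∧ Reduced G es k (output n τ))
    (by decide) ?_ ?_ ?_ ?_ ?_
  · intro τ hτ
    simp only [Expr.eval]
    rw [hτ 0 (by decide), hHolds.numEdges]
  · exact fun _ _ _ h => h
  · constructor
    · intro t' _ v
      rw [f₂ 7 (by decide), f₁ 7 (by decide)]
      rfl
    · refine ⟨fun l _ hG => hG.on_univ fun v => ?_, fun j _ hj => absurd hj (Nat.not_lt_zero _)⟩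
      have := hall v
      unfold output at this ⊢
      rwa [f₂ 3 (by decide)]
  · rintro k hk τ hτ hk' ⟨hcl, hR⟩
    have hH : Holds G es D τ := hHolds.congr fun a ha => hτ a (by revert a; decide)
    refine (wp_processEdge hH hdeg hk' (hH.ends k hk).1 (hH.ends k hk).2 hcl (hes.adj hk).ne).mono ?_
    rintro υ s - ⟨hs, hcl', hst⟩
    exact ⟨hs, hcl', hR.step hk hst⟩
  · rintro τ k hτ ⟨-, hR⟩ hk
    simp only [Expr.cost] at hk
    refine ⟨?_, hR⟩
    have : 3000 * (D + 1) ^ 2 + (1 + 1) + 10 ≤ 3000 * (D + 1) ^ 2 + 20 := by omega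
    have := Nat.mul_le_mul_left es.length this
    omega

theorem input_le (n : ℕ) (es : List (Fin n × Fin n)) (a i : ℕ) : input n es a i ≤ n + es.length := by
  have key : ∀ f : Fin n × Fin n → Fin n, (es.map fun e => (f e : ℕ)).getD i 0 ≤ n := by
    intro f
    by_cases h : i < es.length
    · rw [List.getD_eq_getElem _ _ (by simpa using h), List.getElem_map]
      exact (f _).isLt.le
    · rw [List.getD_eq_default _ _ (by simpa using h)]
      exact Nat.zero_le _
  unfold input
  split
  · omega
  · omega
  · exact (key Prod.fst).trans (by omega)
  · exact (key Prod.snd).trans (by omega)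
  · omega

end RAM

/-! ### The theorem: assembling the bounds -/

theorem mainTheorem7 :
    ∃ (P : RAM.Program) (C : ℕ), ∀ (n : ℕ) (G : SimpleGraph (Fin n)) (es : List (Fin n × Fin n)),
      G.IsQuasiLine → RAM.IsEdgeList G es →
      ∃ (τ : RAM.Mem) (t : ℕ),
        RAM.Runs (C * (n + G.edgeSet.ncard + 1) ^ C) P (RAM.input n es) τ t ∧
        t ≤ C * (G.edgeSet.ncard ^ 2 + n + 1) ∧
        (G.induce (RAM.output n τ)).IsQuasiLine ∧
        (¬ ∃ A B : Set (RAM.output n τ),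
          (G.induce (RAM.output n τ)).IsNonlinearHomogeneousPair A B) ∧
        ∀ k : ℕ, Odd k → G.HasHole k → (G.induce (RAM.output n τ)).HasHole k := by
  refine ⟨RAM.mainProgram, 300000 ^ 8, fun n G es hG hes => ?_⟩
  classical
  obtain ⟨m, hm⟩ : ∃ m, es.length = m := ⟨_, rfl⟩
  have hE : G.edgeFinset.card = m := by
    rw [← hm, ← hes.length_eq, ← SimpleGraph.coe_edgeFinset, Set.ncard_coe_finset]
  -- This is where being quasi-line enters the time bound: `D` is the integer square root of `4 *
  -- m`.
  have hdeg : ∀ v, G.degree v ≤ Nat.sqrt (4 * m) := fun v => by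
    rw [Nat.le_sqrt', ← hE]
    exact hG.degree_sq_le v
  obtain ⟨τ, t, hrun, ht, hR⟩ := RAM.wp_mainProgram hdeg hes
  have hD := Nat.sqrt_le' (4 * m)
  obtain ⟨D, hDD⟩ : ∃ D, Nat.sqrt (4 * m) = D := ⟨_, rfl⟩
  rw [hDD] at hD ht
  rw [hm] at ht
  have htime : t ≤ 40000 * (m ^ 2 + n + 1) := by
    -- From `2 * D ≤ D ^ 2 + 1` and `D ^ 2 ≤ 4 * m`.
    have h1 : (D + 1) ^ 2 ≤ 8 * m + 2 := by nlinarith [two_mul_le_add_sq D 1]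
    have h2 : m * (3000 * (D + 1) ^ 2 + 20) ≤ m * (24000 * m + 6020) :=
      Nat.mul_le_mul_left _ (by omega)
    have h3 : m ≤ m ^ 2 := Nat.le_self_pow two_ne_zero _
    have h4 : m * (24000 * m + 6020) = 24000 * m ^ 2 + 6020 * m := by ring
    omega
  rw [hes.length_eq, hm]
  have hC : 40000 ≤ 300000 ^ 8 := by norm_num
  refine ⟨τ, t, ?_, htime.trans (Nat.mul_le_mul_right _ hC), hG.induce _, ?_, ?_⟩
  -- The base `B` exceeds `n + m` plus three times the time bound. Its eighth power, for rank `8`,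
  -- is `300000 ^ 8 * (n + m + 1) ^ 16`, which accounts for the choice of the constant.
  · refine (hrun.runs RAM.tame_mainProgram (B := 300000 * (n + m + 1) ^ 2) ?_ (n + m)
      (fun a i => hm ▸ RAM.input_le n es a i) ?_).1
    · rw [mul_pow, ← pow_mul]
      exact Nat.mul_le_mul_left _ (Nat.pow_le_pow_right (by omega) (by norm_num))
    · nlinarith
  · rw [hm.symm] at *
    exact hR.not_nonlinear hes
  · exact fun k hk hh => (hR.holes k hk hh).induce
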